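/- Let $n\ge 0$, $\hbar,m>0$, $t_0<t_1$. Let $\psi:[t_0,t_1]\times\mathbb R^n\to\mathbb C$ be a never vanishing classical solution of the free Schrödinger equation $\partial_t\psi=\frac{i\hbar}{2m}\Delta\psi$ with initial condition $\psi(t_0,\cdot)=\psi_0$; that is, $\psi$ is continuous and nowhere zero on $[t_0,t_1]\times\mathbb R^n$, of class $C^{2,1}$ (two continuous space derivatives, one continuous time derivative) on $(t_0,t_1)\times\mathbb R^n$, and satisfies the equation there. Put $v_q=\frac{\hbar}{im}\nabla\log\psi=\frac{\hbar}{im}\frac{\nabla\psi}{\psi}$ and consider the equation $$\Big(\partial_t+v_q\cdot\nabla-\frac{i\hbar}{2m}\Delta\Big)u=0.\qquad(*)$$ A fundamental solution of $(*)$ with initial time $t_0$ is a function $p_q(t_0,y,t,x)$, continuous in $(y,t,x)\in\mathbb R^n\times(t_0,t_1]\times\mathbb R^n$, such that (i) for each $y$ it is, as a function of $(t,x)$, a $C^{2,1}$ solution of $(*)$ on $(t_0,t_1)\times\mathbb R^n$; (ii) for every continuous, compactly supported $f:\mathbb R^n\to\mathbb C$, the function $u(t,x)=\int p_q(t_0,y,t,x)f(y)\,dy$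 is a $C^{2,1}$ solution of $(*)$ on $(t_0,t_1)\times\mathbb R^n$ with $\int_{t_0}^{t_1}\int|\psi u|^2\,dx\,dt<\infty$, and $\int|u(t,x)-f(x)|^2|\psi(t,x)|^2dx\to0$ as $t\downarrow t_0$. Then such a fundamental solution $p_q$ exists, and the kernel $\frac{\psi(t,x)}{\psi_0(y)}p_q(t_0,y,t,x)$ does not depend on $\psi$: for every fundamental solution $p_q$ of $(*)$ and all $y,x\in\mathbb R^n$, $t\in(t_0,t_1]$, $$\frac{\psi(t,x)}{\psi_0(y)}\,p_q(t_0,y,t,x)=K(t_0,y,t,x)=\Big[\frac{2\pi\hbar i(t-t_0)}{m}\Big]^{-n/2}\exp\Big[\frac{im|x-y|^2}{2\hbar(t-t_0)}\Big],$$ where the power is the principal one. -/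

import Mathlib

noncomputable section

/-- The function `u(t, x)` is of class `C^{2,1}` on `(t₀, t₁) × ℝⁿ`: continuous, with one continuous
time derivative and two continuous space derivatives. -/
structure IsC21On {n : ℕ} (t₀ t₁ : ℝ) (u : ℝ → EuclideanSpace ℝ (Fin n) → ℂ) : Prop where
  contDiff_space : ∀ t ∈ Set.Ioo t₀ t₁, ContDiff ℝ 2 (u t)
  differentiable_time : ∀ t ∈ Set.Ioo t₀ t₁, ∀ x, DifferentiableAt ℝ (fun s => u s x) t
  continuousOn : ContinuousOn (fun q : ℝ × EuclideanSpace ℝ (Fin n) => u q.1 q.2)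
    (Set.Ioo t₀ t₁ ×ˢ Set.univ)
  continuousOn_time : ContinuousOn
    (fun q : ℝ × EuclideanSpace ℝ (Fin n) => deriv (fun s => u s q.2) q.1)
    (Set.Ioo t₀ t₁ ×ˢ Set.univ)
  continuousOn_space : ContinuousOn
    (fun q : ℝ × EuclideanSpace ℝ (Fin n) => fderiv ℝ (u q.1) q.2)
    (Set.Ioo t₀ t₁ ×ˢ Set.univ)
  continuousOn_space_space : ContinuousOn
    (fun q : ℝ × EuclideanSpace ℝ (Fin n) => fderiv ℝ (fderiv ℝ (u q.1)) q.2)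
    (Set.Ioo t₀ t₁ ×ˢ Set.univ)

/-- The partial derivative `∂g/∂x_j` at `x`. -/
def spaceDeriv {n : ℕ} (g : EuclideanSpace ℝ (Fin n) → ℂ) (j : Fin n)
    (x : EuclideanSpace ℝ (Fin n)) : ℂ :=
  fderiv ℝ g x (EuclideanSpace.single j 1)

/-- `ψ` is a classical, never vanishing solution on `[t₀, t₁]` of the free Schrödinger equation
`∂ψ/∂t = (iħ/2m) Δψ` with initial condition `ψ(t₀, ·) = ψ₀`. -/
structure IsNonvanishingFreeWave {n : ℕ} (hbar m t₀ t₁ : ℝ)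
    (ψ : ℝ → EuclideanSpace ℝ (Fin n) → ℂ) (ψ₀ : EuclideanSpace ℝ (Fin n) → ℂ) : Prop where
  continuousOn : ContinuousOn (fun q : ℝ × EuclideanSpace ℝ (Fin n) => ψ q.1 q.2)
    (Set.Icc t₀ t₁ ×ˢ Set.univ)
  ne_zero : ∀ t ∈ Set.Icc t₀ t₁, ∀ x, ψ t x ≠ 0
  isC21On : IsC21On t₀ t₁ ψ
  schrodinger : ∀ t ∈ Set.Ioo t₀ t₁, ∀ x,
    deriv (fun s => ψ s x) t = Complex.I * hbar / (2 * m) * Laplacian.laplacian (ψ t) x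
  initial : ∀ x, ψ t₀ x = ψ₀ x

/-- The quantum drift `v_q = (ħ/(im)) ∇ log ψ`, where `∇ log ψ = ∇ψ/ψ` for every local branch of the
logarithm (`ψ` does not vanish). -/
def quantumDrift {n : ℕ} (hbar m : ℝ) (ψ : ℝ → EuclideanSpace ℝ (Fin n) → ℂ)
    (t : ℝ) (x : EuclideanSpace ℝ (Fin n)) (j : Fin n) : ℂ :=
  hbar / (Complex.I * m) * (spaceDeriv (ψ t) j x / ψ t x)

/-- `u` is a classical solution on `(t₀, t₁) × ℝⁿ` of
`(∂/∂t + v_q · ∇ - (iħ/2m) Δ) u = 0`, with `v_q` the quantum drift of `ψ`. -/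
structure IsDriftSolution {n : ℕ} (hbar m t₀ t₁ : ℝ)
    (ψ u : ℝ → EuclideanSpace ℝ (Fin n) → ℂ) : Prop where
  isC21On : IsC21On t₀ t₁ u
  equation : ∀ t ∈ Set.Ioo t₀ t₁, ∀ x,
    deriv (fun s => u s x) t
      + ∑ j, quantumDrift hbar m ψ t x j * spaceDeriv (u t) j x
      - Complex.I * hbar / (2 * m) * Laplacian.laplacian (u t) x = 0

/-- `u` solves the Cauchy problem for `(∂/∂t + v_q · ∇ - (iħ/2m) Δ) u = 0` with initial datum `f` at
time `t₀`, in the space of functions `g` with `∫_{t₀}^{t₁} ∫ |ψ g|² dx dt < ∞` on which the operator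
`∂/∂t + v_q · ∇ - (iħ/2m) Δ` acts. The datum is attained in the sense of `L²(|ψ(t, x)|² dx)`. -/
structure IsCauchySolution {n : ℕ} (hbar m t₀ t₁ : ℝ)
    (ψ u : ℝ → EuclideanSpace ℝ (Fin n) → ℂ) (f : EuclideanSpace ℝ (Fin n) → ℂ) : Prop where
  isDriftSolution : IsDriftSolution hbar m t₀ t₁ ψ u
  weighted_sq_integrable : ∫⁻ t in Set.Ioo t₀ t₁, ∫⁻ x, ‖ψ t x * u t x‖ₑ ^ 2 < ⊤
  initial : Filter.Tendsto (fun t => ∫⁻ x, ‖u t x - f x‖ₑ ^ 2 * ‖ψ t x‖ₑ ^ 2)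
    (nhdsWithin t₀ (Set.Ioi t₀)) (nhds 0)

/-- `p y t x` (that is, `p(t₀, y, t, x)`) is a fundamental solution, with initial time `t₀`, of
`(∂/∂t + v_q · ∇ - (iħ/2m) Δ) u = 0`: it is continuous in `(y, t, x)`, it solves the equation in
`(t, x)` for each source point `y`, and `u(t, x) = ∫ p(t₀, y, t, x) f(y) dy` solves the Cauchy problem
with initial datum `f`, for every continuous compactly supported `f`. -/
structure IsFundamentalSolution {n : ℕ} (hbar m t₀ t₁ : ℝ)
    (ψ : ℝ → EuclideanSpace ℝ (Fin n) → ℂ)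
    (p : EuclideanSpace ℝ (Fin n) → ℝ → EuclideanSpace ℝ (Fin n) → ℂ) : Prop where
  continuousOn : ContinuousOn
    (fun q : EuclideanSpace ℝ (Fin n) × ℝ × EuclideanSpace ℝ (Fin n) => p q.1 q.2.1 q.2.2)
    (Set.univ ×ˢ Set.Ioc t₀ t₁ ×ˢ Set.univ)
  solves : ∀ y, IsDriftSolution hbar m t₀ t₁ ψ (p y)
  cauchy : ∀ f : EuclideanSpace ℝ (Fin n) → ℂ, Continuous f → HasCompactSupport f →
    IsCauchySolution hbar m t₀ t₁ ψ (fun t x => ∫ y, p y t x * f y) f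

/-- The free Schrödinger kernel
`K(t₀, y, t, x) = [2πħi(t - t₀)/m]^{-n/2} exp[im|x - y|²/(2ħ(t - t₀))]` (principal branch). -/
def freeSchrodingerKernel {n : ℕ} (hbar m t₀ : ℝ) (y : EuclideanSpace ℝ (Fin n)) (t : ℝ)
    (x : EuclideanSpace ℝ (Fin n)) : ℂ :=
  (2 * Real.pi * hbar * Complex.I * (t - t₀) / m : ℂ) ^ (-(n : ℂ) / 2)
    * Complex.exp (Complex.I * m * (‖x - y‖ : ℂ) ^ 2 / (2 * hbar * (t - t₀)))

end

section FreeSchrodinger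

open MeasureTheory Filter Topology Set

variable {n : ℕ}

/-! ### Derivatives of products and inverses -/

/-! The substitution w = ψu turns (*) into the free Schrödinger equation. In Δ(ψu) the cross term
2∇ψ·∇u, multiplied by iħ/2m and divided by ψ, is exactly -v_q·∇u, and the term uΔψ cancels against
u∂ₜψ because ψ is itself a wave (`schrodinger_iff_drift`). The weighted L² conditions on u become
plain L² conditions on w, with initial datum ψ₀f. So ψ(t,x)p_q/ψ₀(y) has to be the kernel of the
free flow, which knows nothing about ψ.

Existence: p_q = ψ₀(y)K/ψ is taken as the definition, and convolution with K must be shown to be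
bounded in L² and continuous in L² at time t₀. No Fourier transform is used. K is the heat kernel at
the imaginary time iħ(t-t₀)/2m. For Re z > 0 everything is absolutely integrable, and the semigroup
law `integral_heatKernel_mul` expresses the L² inner product of the flows at z and z' by `gaussForm`
at z + conj z' (`integral_heatFlow_mul_conj`). For equal imaginary parts these arguments are real,
and `gaussForm` tends to ‖g‖² at 0+ (`tendsto_gaussForm`). The resulting bounds do not depend on Im
z, and Fatou's lemma carries them to the imaginary axis.

Uniqueness: a Cauchy solution is only known to be square integrable in space-time, so it is tested
against Gaussians. Fix a time s and a point b. The kernel at complex time ε + iκ(s-r), with κ =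
ħ/2m, centred at b, solves the adjoint equation in r and decays like a Gaussian uniformly in r. Its
pairing with w is conserved: with a cutoff at scale k the error is O(1/k), thanks to the space-time
L² bound (`integral_mul_eq_of_square_integrable`). Letting r decrease to t₀ gives the flow of ψ₀f at
time ε + iκ(s-t₀); letting ε → 0 recovers w(s,b) (`eq_heatFlow_of_square_integrable`). This works
for almost every s, hence for every s by continuity. Varying f then identifies the kernel
(`IsFundamentalSolution.mul_eq`). -/

lemma laplacian_eq_sum_fderiv_fderiv (g : EuclideanSpace ℝ (Fin n) → ℂ)
    (x : EuclideanSpace ℝ (Fin n)) :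
    Laplacian.laplacian g x =
      ∑ j, fderiv ℝ (fderiv ℝ g) x (EuclideanSpace.single j 1) (EuclideanSpace.single j 1) := by
  rw [InnerProductSpace.laplacian_eq_iteratedFDeriv_orthonormalBasis g
    (EuclideanSpace.basisFun (Fin n) ℝ)]
  simp [iteratedFDeriv_two_apply]

lemma fderiv_mul_fun {f g : EuclideanSpace ℝ (Fin n) → ℂ} (hf : Differentiable ℝ f)
    (hg : Differentiable ℝ g) :
    fderiv ℝ (fun x => f x * g x) = fun x => f x • fderiv ℝ g x + g x • fderiv ℝ f x := by
  ext1 x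
  exact fderiv_fun_mul (hf x) (hg x)

lemma fderiv_fderiv_mul {f g : EuclideanSpace ℝ (Fin n) → ℂ} (hf : ContDiff ℝ 2 f)
    (hg : ContDiff ℝ 2 g) (x : EuclideanSpace ℝ (Fin n)) :
    fderiv ℝ (fderiv ℝ (fun x => f x * g x)) x =
      (f x • fderiv ℝ (fderiv ℝ g) x + (fderiv ℝ f x).smulRight (fderiv ℝ g x)) +
      (g x • fderiv ℝ (fderiv ℝ f) x + (fderiv ℝ g x).smulRight (fderiv ℝ f x)) := by
  have hf1 : Differentiable ℝ f := hf.differentiable (by norm_num)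
  have hg1 : Differentiable ℝ g := hg.differentiable (by norm_num)
  have hf2 : Differentiable ℝ (fderiv ℝ f) :=
    (hf.fderiv_right (m := 1) (by norm_num)).differentiable (by norm_num)
  have hg2 : Differentiable ℝ (fderiv ℝ g) :=
    (hg.fderiv_right (m := 1) (by norm_num)).differentiable (by norm_num)
  rw [fderiv_mul_fun hf1 hg1, fderiv_fun_add ((hf1 x).fun_smul (hg2 x)) ((hg1 x).fun_smul (hf2 x)),
    fderiv_fun_smul (hf1 x) (hg2 x), fderiv_fun_smul (hg1 x) (hf2 x)]

lemma laplacian_mul {f g : EuclideanSpace ℝ (Fin n) → ℂ} (hf : ContDiff ℝ 2 f)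
    (hg : ContDiff ℝ 2 g) (x : EuclideanSpace ℝ (Fin n)) :
    Laplacian.laplacian (fun x => f x * g x) x =
      f x * Laplacian.laplacian g x + 2 * ∑ j, spaceDeriv f j x * spaceDeriv g j x
        + Laplacian.laplacian f x * g x := by
  simp only [laplacian_eq_sum_fderiv_fderiv, fderiv_fderiv_mul hf hg, Finset.mul_sum,
    Finset.sum_mul, ← Finset.sum_add_distrib]
  refine Finset.sum_congr rfl fun j _ => ?_
  simp [spaceDeriv]
  ring

lemma fderiv_inv_fun {f : EuclideanSpace ℝ (Fin n) → ℂ} (hf : Differentiable ℝ f)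
    (h0 : ∀ x, f x ≠ 0) :
    fderiv ℝ (fun x => (f x)⁻¹) = fun x => (-(f x ^ 2)⁻¹) • fderiv ℝ f x := by
  ext1 x
  refine (((hasDerivAt_inv (h0 x)).hasFDerivAt.restrictScalars ℝ).comp x
    (hf x).hasFDerivAt).fderiv.trans ?_
  ext v
  simp [mul_comm]

lemma fderiv_fderiv_inv {f : EuclideanSpace ℝ (Fin n) → ℂ} (hf : ContDiff ℝ 2 f)
    (h0 : ∀ x, f x ≠ 0) (x : EuclideanSpace ℝ (Fin n)) :
    fderiv ℝ (fderiv ℝ (fun x => (f x)⁻¹)) x =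
      (-(f x ^ 2)⁻¹) • fderiv ℝ (fderiv ℝ f) x +
        ((2 * (f x ^ 3)⁻¹) • fderiv ℝ f x).smulRight (fderiv ℝ f x) := by
  have hf1 : Differentiable ℝ f := hf.differentiable (by norm_num)
  have hf2 : Differentiable ℝ (fderiv ℝ f) :=
    (hf.fderiv_right (m := 1) (by norm_num)).differentiable (by norm_num)
  have hc : HasFDerivAt (fun x => -(f x ^ 2)⁻¹) ((2 * (f x ^ 3)⁻¹) • fderiv ℝ f x) x := by
    have hd : HasDerivAt (fun w : ℂ => -(w ^ 2)⁻¹) (2 * (f x ^ 3)⁻¹) (f x) := by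
      convert! ((hasDerivAt_pow 2 (f x)).inv (pow_ne_zero 2 (h0 x))).neg using 1
      have := h0 x
      field_simp
      simp
    refine ((hd.hasFDerivAt.restrictScalars ℝ).comp x (hf1 x).hasFDerivAt).congr_fderiv ?_
    ext v
    simp [mul_comm]
  rw [fderiv_inv_fun hf1 h0, fderiv_fun_smul hc.differentiableAt (hf2 x), hc.fderiv]

/-- The mixed terms in the second derivatives of products and inverses are `smulRight` of two
gradients. The scalars are complex but the maps are only real linear, so joint continuity comes from
a bounded ℝ-bilinear map, with bound 1. -/
lemma continuousOn_smulRight {X : Type*} [TopologicalSpace X] {s : Set X}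
    {V F : Type*} [NormedAddCommGroup V] [NormedSpace ℝ V] [NormedAddCommGroup F]
    [NormedSpace ℝ F] [NormedSpace ℂ F] [IsScalarTower ℝ ℂ F]
    {a : X → V →L[ℝ] ℂ} {b : X → F} (ha : ContinuousOn a s) (hb : ContinuousOn b s) :
    ContinuousOn (fun q => (a q).smulRight (b q)) s := by
  have h : Continuous (fun p : (V →L[ℝ] ℂ) × F => p.1.smulRight p.2) := by
    have : IsBoundedBilinearMap ℝ (fun p : (V →L[ℝ] ℂ) × F => p.1.smulRight p.2) :=
      { add_left := fun x y z => by ext; simp [add_smul]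
        smul_left := fun c x y => by
          ext
          simp only [ContinuousLinearMap.smulRight_apply, smul_apply, smul_assoc]
        add_right := fun x y z => by ext; simp
        smul_right := fun c x y => by
          ext
          simp only [ContinuousLinearMap.smulRight_apply, smul_apply]
          rw [smul_comm]
        bound := ⟨1, one_pos, fun x y => by
          rw [one_mul]
          refine ContinuousLinearMap.opNorm_le_bound _ (by positivity) fun w => ?_
          rw [ContinuousLinearMap.smulRight_apply, norm_smul]
          nlinarith [x.le_opNorm w, norm_nonneg y, norm_nonneg (x w)]⟩ }
    exact this.continuous
  exact h.comp_continuousOn (ha.prodMk hb)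

lemma continuousOn_complex_smul {X : Type*} [TopologicalSpace X] {s : Set X}
    {F : Type*} [NormedAddCommGroup F] [NormedSpace ℂ F]
    {a : X → ℂ} {b : X → F} (ha : ContinuousOn a s) (hb : ContinuousOn b s) :
    ContinuousOn (fun q => a q • b q) s :=
  ha.smul hb

/-! ### The class `C^{2,1}` -/

section C21

variable {t₀ t₁ : ℝ} {u v : ℝ → EuclideanSpace ℝ (Fin n) → ℂ}

lemma IsC21On.congr (hu : IsC21On t₀ t₁ u) (h : ∀ t ∈ Ioo t₀ t₁, ∀ x, v t x = u t x) :
    IsC21On t₀ t₁ v := by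
  have h' : ∀ t ∈ Ioo t₀ t₁, v t = u t := fun t ht => funext (h t ht)
  have hd : ∀ t ∈ Ioo t₀ t₁, ∀ x, (fun s => v s x) =ᶠ[𝓝 t] fun s => u s x := fun t ht x => by
    filter_upwards [isOpen_Ioo.mem_nhds ht] with s hs using h s hs x
  refine ⟨fun t ht => h' t ht ▸ hu.contDiff_space t ht,
    fun t ht x => (hu.differentiable_time t ht x).congr_of_eventuallyEq (hd t ht x),
    hu.continuousOn.congr fun q hq => h q.1 hq.1 q.2,
    hu.continuousOn_time.congr fun q hq => (hd q.1 hq.1 q.2).deriv_eq,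
    hu.continuousOn_space.congr fun q hq => ?_,
    hu.continuousOn_space_space.congr fun q hq => ?_⟩ <;> simp only [h' q.1 hq.1]

lemma IsC21On.differentiable (hu : IsC21On t₀ t₁ u) {t : ℝ} (ht : t ∈ Ioo t₀ t₁) :
    Differentiable ℝ (u t) :=
  (hu.contDiff_space t ht).differentiable (by norm_num)

lemma IsC21On.mul (hu : IsC21On t₀ t₁ u) (hv : IsC21On t₀ t₁ v) :
    IsC21On t₀ t₁ (fun t x => u t x * v t x) where
  contDiff_space t ht := (hu.contDiff_space t ht).mul (hv.contDiff_space t ht)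
  differentiable_time t ht x := (hu.differentiable_time t ht x).mul (hv.differentiable_time t ht x)
  continuousOn := hu.continuousOn.mul hv.continuousOn
  continuousOn_time := by
    refine ((hu.continuousOn_time.mul hv.continuousOn).add
      (hu.continuousOn.mul hv.continuousOn_time)).congr fun q hq => ?_
    exact deriv_fun_mul (hu.differentiable_time q.1 hq.1 q.2) (hv.differentiable_time q.1 hq.1 q.2)
  continuousOn_space := by
    refine ((hu.continuousOn.smul hv.continuousOn_space).add
      (hv.continuousOn.smul hu.continuousOn_space)).congr fun q hq => ?_
    exact fderiv_fun_mul (hu.differentiable hq.1 q.2) (hv.differentiable hq.1 q.2)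
  continuousOn_space_space := by
    refine (((continuousOn_complex_smul hu.continuousOn hv.continuousOn_space_space).add
      (continuousOn_smulRight hu.continuousOn_space hv.continuousOn_space)).add
      ((continuousOn_complex_smul hv.continuousOn hu.continuousOn_space_space).add
      (continuousOn_smulRight hv.continuousOn_space hu.continuousOn_space))).congr fun q hq => ?_
    exact fderiv_fderiv_mul (hu.contDiff_space _ hq.1) (hv.contDiff_space _ hq.1) q.2

lemma IsC21On.inv (hu : IsC21On t₀ t₁ u) (h0 : ∀ t ∈ Ioo t₀ t₁, ∀ x, u t x ≠ 0) :
    IsC21On t₀ t₁ (fun t x => (u t x)⁻¹) where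
  contDiff_space t ht := (hu.contDiff_space t ht).inv (h0 t ht)
  differentiable_time t ht x := (hu.differentiable_time t ht x).inv (h0 t ht x)
  continuousOn := hu.continuousOn.inv₀ fun q hq => h0 q.1 hq.1 q.2
  continuousOn_time := by
    refine (hu.continuousOn_time.neg.div (hu.continuousOn.pow 2)
      fun q hq => pow_ne_zero 2 (h0 q.1 hq.1 q.2)).congr fun q hq => ?_
    exact deriv_fun_inv'' (hu.differentiable_time q.1 hq.1 q.2) (h0 q.1 hq.1 q.2)
  continuousOn_space := by
    refine (((hu.continuousOn.pow 2).inv₀ fun q hq => pow_ne_zero 2 (h0 q.1 hq.1 q.2)).neg.smul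
      hu.continuousOn_space).congr fun q hq => ?_
    exact congrFun (fderiv_inv_fun (hu.differentiable hq.1) (h0 q.1 hq.1)) q.2
  continuousOn_space_space := by
    refine ((continuousOn_complex_smul ((hu.continuousOn.pow 2).inv₀ fun q hq =>
      pow_ne_zero 2 (h0 q.1 hq.1 q.2)).neg hu.continuousOn_space_space).add (continuousOn_smulRight
      (((continuousOn_const (c := (2 : ℂ))).mul ((hu.continuousOn.pow 3).inv₀
        fun q hq => pow_ne_zero 3 (h0 q.1 hq.1 q.2))).smul
      hu.continuousOn_space) hu.continuousOn_space)).congr fun q hq => ?_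
    exact fderiv_fderiv_inv (hu.contDiff_space _ hq.1) (h0 q.1 hq.1) q.2

lemma isC21On_const (c : ℂ) :
    IsC21On t₀ t₁ (fun (_ : ℝ) (_ : EuclideanSpace ℝ (Fin n)) => c) where
  contDiff_space t ht := contDiff_const
  differentiable_time t ht x := differentiableAt_const _
  continuousOn := continuousOn_const
  continuousOn_time := by simpa using continuousOn_const
  continuousOn_space := by simpa using continuousOn_const
  continuousOn_space_space := by simpa using continuousOn_const

lemma IsC21On.continuousOn_spaceDeriv (hu : IsC21On t₀ t₁ u) (j : Fin n) :
    ContinuousOn (fun q : ℝ × EuclideanSpace ℝ (Fin n) => spaceDeriv (u q.1) j q.2)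
      (Ioo t₀ t₁ ×ˢ univ) :=
  hu.continuousOn_space.clm_apply continuousOn_const

end C21

/-! ### The drift equation and the free Schrödinger equation -/

/-- This is the conjugation on which everything rests. It is a pointwise equivalence, so one
direction serves existence and the other uniqueness. -/
lemma schrodinger_iff_drift {hbar m t₀ t₁ : ℝ} (hm : 0 < m)
    {ψ u : ℝ → EuclideanSpace ℝ (Fin n) → ℂ} {ψ₀ : EuclideanSpace ℝ (Fin n) → ℂ}
    (hψ : IsNonvanishingFreeWave hbar m t₀ t₁ ψ ψ₀) (hu : IsC21On t₀ t₁ u)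
    {t : ℝ} (ht : t ∈ Ioo t₀ t₁) (x : EuclideanSpace ℝ (Fin n)) :
    deriv (fun s => ψ s x * u s x) t = Complex.I * hbar / (2 * m) *
        Laplacian.laplacian (fun x => ψ t x * u t x) x ↔
    deriv (fun s => u s x) t
      + ∑ j, quantumDrift hbar m ψ t x j * spaceDeriv (u t) j x
      - Complex.I * hbar / (2 * m) * Laplacian.laplacian (u t) x = 0 := by
  have h0 : ψ t x ≠ 0 := hψ.ne_zero t (Ioo_subset_Icc_self ht) x
  have hm' : (m : ℂ) ≠ 0 := by exact_mod_cast hm.ne'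
  rw [deriv_fun_mul (hψ.isC21On.differentiable_time t ht x) (hu.differentiable_time t ht x),
    laplacian_mul (hψ.isC21On.contDiff_space t ht) (hu.contDiff_space t ht),
    hψ.schrodinger t ht x]
  have hs : ∑ j, quantumDrift hbar m ψ t x j * spaceDeriv (u t) j x =
      -(Complex.I * hbar / m) * (∑ j, spaceDeriv (ψ t) j x * spaceDeriv (u t) j x) / ψ t x := by
    rw [Finset.mul_sum, Finset.sum_div]
    refine Finset.sum_congr rfl fun j _ => ?_
    rw [quantumDrift]
    field_simp
    simp
  rw [hs]
  generalize ∑ j, spaceDeriv (ψ t) j x * spaceDeriv (u t) j x = S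
  -- The difference of the two sides of the Schrödinger equation for ψu equals ψ times the drift
  -- operator applied to u; the factor ψ ≠ 0 is then dropped.
  refine sub_eq_zero.symm.trans (Iff.trans ?_ (or_iff_right h0))
  rw [← mul_eq_zero]
  refine Eq.congr_left ?_
  field_simp
  ring

/-! ### The heat kernel with complex time -/

/-- The heat kernel `(4πz)^{-n/2} exp(-|x|²/(4z))` with complex time `z`. -/
noncomputable def heatKernel (z : ℂ) (x : EuclideanSpace ℝ (Fin n)) : ℂ :=
  (4 * Real.pi * z) ^ (-(n : ℂ) / 2) * Complex.exp (-(‖x‖ : ℂ) ^ 2 / (4 * z))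

/-- With z = iħ(t-t₀)/2m, 4πz is literally the base of the power in K, so the principal branches
agree with no further argument. -/
lemma freeSchrodingerKernel_eq_heatKernel {hbar m t₀ t : ℝ} (hbar_pos : 0 < hbar) (hm : 0 < m)
    (ht : t₀ < t) (y x : EuclideanSpace ℝ (Fin n)) :
    freeSchrodingerKernel hbar m t₀ y t x =
      heatKernel (Complex.I * hbar / (2 * m) * (t - t₀)) (x - y) := by
  have hm' : (m : ℂ) ≠ 0 := by exact_mod_cast hm.ne'
  have hh : (hbar : ℂ) ≠ 0 := by exact_mod_cast hbar_pos.ne'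
  have ht' : (t : ℂ) - t₀ ≠ 0 := by exact_mod_cast (sub_pos.2 ht).ne'
  rw [freeSchrodingerKernel, heatKernel]
  congr 2
  · field_simp
    norm_num
  · field_simp
    rw [Complex.I_sq]
    ring

lemma four_pi_mul_mem_slitPlane {z : ℂ} (hz : z ∈ Complex.slitPlane) :
    4 * Real.pi * z ∈ Complex.slitPlane := by
  have h : (4 * Real.pi * z : ℂ) = ((4 * Real.pi : ℝ) : ℂ) * z := by push_cast; ring
  have hp : 0 < 4 * Real.pi := by positivity
  rw [h, Complex.mem_slitPlane_iff, Complex.re_ofReal_mul, Complex.im_ofReal_mul]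
  rw [Complex.mem_slitPlane_iff] at hz
  exact hz.imp (fun h => by positivity) (fun h => mul_ne_zero hp.ne' h)

/-- The factor is the same as in `laplacian_heatKernel`, which is the heat equation in complex time.
The slit plane is where the principal power is holomorphic; it contains both the right half-plane
and the nonzero imaginary times. -/
lemma hasDerivAt_heatKernel {z : ℂ} (hz : z ∈ Complex.slitPlane) (x : EuclideanSpace ℝ (Fin n)) :
    HasDerivAt (fun w => heatKernel w x)
      ((-(n : ℂ) / (2 * z) + (‖x‖ : ℂ) ^ 2 / (4 * z ^ 2)) * heatKernel z x) z := by
  have hz0 : z ≠ 0 := Complex.slitPlane_ne_zero hz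
  have hp : (Real.pi : ℂ) ≠ 0 := by exact_mod_cast Real.pi_ne_zero
  have h1 : HasDerivAt (fun w : ℂ => (4 * Real.pi * w) ^ (-(n : ℂ) / 2))
      (-(n : ℂ) / (2 * z) * (4 * Real.pi * z) ^ (-(n : ℂ) / 2)) z := by
    have h := ((hasDerivAt_id z).const_mul (4 * Real.pi : ℂ)).cpow_const
      (c := -(n : ℂ) / 2) (four_pi_mul_mem_slitPlane hz)
    refine h.congr_deriv ?_
    simp only [id]
    rw [Complex.cpow_sub _ _ (by simp [hp, hz0]), Complex.cpow_one]
    field_simp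
  have h2 : HasDerivAt (fun w : ℂ => Complex.exp (-(‖x‖ : ℂ) ^ 2 / (4 * w)))
      (Complex.exp (-(‖x‖ : ℂ) ^ 2 / (4 * z)) * ((‖x‖ : ℂ) ^ 2 / (4 * z ^ 2))) z := by
    have h3 : HasDerivAt (fun w : ℂ => -(‖x‖ : ℂ) ^ 2 / (4 * w)) ((‖x‖ : ℂ) ^ 2 / (4 * z ^ 2)) z := by
      refine ((((hasDerivAt_id z).const_mul (4 : ℂ)).fun_inv (by simpa using hz0)).const_mul
        (-(‖x‖ : ℂ) ^ 2)).congr_deriv ?_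
      simp only [id]
      field_simp
    exact h3.cexp
  refine (h1.mul h2).congr_deriv ?_
  rw [heatKernel]
  ring

lemma contDiff_heatKernel (z : ℂ) {k : WithTop ℕ∞} :
    ContDiff ℝ k (heatKernel z : EuclideanSpace ℝ (Fin n) → ℂ) := by
  have h : (heatKernel z : EuclideanSpace ℝ (Fin n) → ℂ) = fun x =>
      (4 * Real.pi * z) ^ (-(n : ℂ) / 2) *
        Complex.exp (-Complex.ofRealCLM (‖x‖ ^ 2) / (4 * z)) := by
    ext x; simp [heatKernel]
  rw [h]
  exact contDiff_const.mul (((Complex.ofRealCLM.contDiff.comp (contDiff_norm_sq ℝ)).neg.div_const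
    _).cexp)

lemma spaceDeriv_heatKernel (z : ℂ) (x : EuclideanSpace ℝ (Fin n)) (j : Fin n) :
    spaceDeriv (heatKernel z) j x = -(x j : ℂ) / (2 * z) * heatKernel z x := by
  have h1 : HasFDerivAt (fun x : EuclideanSpace ℝ (Fin n) => ‖x‖ ^ 2) (2 • innerSL ℝ x) x :=
    (hasStrictFDerivAt_norm_sq x).hasFDerivAt
  have h2 := Complex.ofRealCLM.hasFDerivAt.comp x h1
  have h3 : HasDerivAt (fun w : ℂ => (4 * Real.pi * z) ^ (-(n : ℂ) / 2) *
      Complex.exp (-w / (4 * z))) ((4 * Real.pi * z) ^ (-(n : ℂ) / 2) *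
      (Complex.exp (-((‖x‖ ^ 2 : ℝ) : ℂ) / (4 * z)) * (-1 / (4 * z)))) ((‖x‖ ^ 2 : ℝ) : ℂ) :=
    (((hasDerivAt_id _).neg.div_const _).cexp).const_mul _
  have h4 := (h3.hasFDerivAt.restrictScalars ℝ).comp x h2
  have h5 : (heatKernel z : EuclideanSpace ℝ (Fin n) → ℂ) =
      ((fun w : ℂ => (4 * Real.pi * z) ^ (-(n : ℂ) / 2) *
      Complex.exp (-w / (4 * z))) ∘ (⇑Complex.ofRealCLM ∘ fun x => ‖x‖ ^ 2)) := by
    ext x; simp [heatKernel]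
  rw [spaceDeriv, h5, h4.fderiv]
  simp [EuclideanSpace.inner_single_right]
  ring

lemma differentiable_fderiv_of_contDiff_two {V F : Type*} [NormedAddCommGroup V] [NormedSpace ℝ V]
    [NormedAddCommGroup F] [NormedSpace ℝ F] {g : V → F} (hg : ContDiff ℝ 2 g) :
    Differentiable ℝ (fderiv ℝ g) :=
  (hg.fderiv_right (m := 1) (by norm_num)).differentiable (by norm_num)

lemma laplacian_eq_sum_spaceDeriv {g : EuclideanSpace ℝ (Fin n) → ℂ} (hg : ContDiff ℝ 2 g)
    (x : EuclideanSpace ℝ (Fin n)) :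
    Laplacian.laplacian g x = ∑ j, spaceDeriv (spaceDeriv g j) j x := by
  rw [laplacian_eq_sum_fderiv_fderiv]
  refine Finset.sum_congr rfl fun j _ => ?_
  have h := (differentiable_fderiv_of_contDiff_two hg x).hasFDerivAt.clm_apply
    (hasFDerivAt_const (EuclideanSpace.single j (1 : ℝ)) x)
  rw [spaceDeriv, show spaceDeriv g j = fun y => fderiv ℝ g y (EuclideanSpace.single j 1) from rfl,
    h.fderiv]
  simp

lemma laplacian_heatKernel {z : ℂ} (hz : z ≠ 0) (x : EuclideanSpace ℝ (Fin n)) :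
    Laplacian.laplacian (heatKernel z) x =
      (-(n : ℂ) / (2 * z) + (‖x‖ : ℂ) ^ 2 / (4 * z ^ 2)) * heatKernel z x := by
  have key : ∀ j : Fin n, spaceDeriv (spaceDeriv (heatKernel z) j) j x =
      (-1 / (2 * z) + (x j : ℂ) ^ 2 / (4 * z ^ 2)) * heatKernel z x := by
    intro j
    have h1 : spaceDeriv (heatKernel z : EuclideanSpace ℝ (Fin n) → ℂ) j =
        fun x => Complex.ofRealCLM (EuclideanSpace.proj j x) * (-1 / (2 * z)) * heatKernel z x := by
      ext y
      rw [spaceDeriv_heatKernel, Complex.ofRealCLM_apply, PiLp.proj_apply]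
      ring
    have h2 : HasFDerivAt (fun x : EuclideanSpace ℝ (Fin n) =>
        Complex.ofRealCLM (EuclideanSpace.proj j x) * (-1 / (2 * z))) _ x :=
      ((Complex.ofRealCLM.comp (EuclideanSpace.proj j)).hasFDerivAt).mul_const (-1 / (2 * z))
    have h3 := h2.fun_mul ((contDiff_heatKernel z (k := 1)).differentiable (by norm_num) x).hasFDerivAt
    have h4 := spaceDeriv_heatKernel z x j
    rw [spaceDeriv] at h4
    rw [h1, spaceDeriv, HasFDerivAt.fderiv h3]
    simp [h4]
    field_simp
    ring
  rw [laplacian_eq_sum_spaceDeriv (contDiff_heatKernel z), Finset.sum_congr rfl fun j _ => key j,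
    ← Finset.sum_mul, Finset.sum_add_distrib, ← Finset.sum_div _ _ (4 * z ^ 2)]
  congr 2
  · simp
    field_simp
  · rw [← Complex.ofReal_pow, EuclideanSpace.real_norm_sq_eq]
    simp

/-- The decay is governed by Re(1/z). It is Gaussian for Re z > 0 and disappears on the imaginary
axis, which is why imaginary times are only approached as limits. -/
lemma norm_heatKernel (z : ℂ) (x : EuclideanSpace ℝ (Fin n)) :
    ‖heatKernel z x‖ =
      ‖(4 * Real.pi * z : ℂ) ^ (-(n : ℂ) / 2)‖ * Real.exp (-((z⁻¹).re / 4) * ‖x‖ ^ 2) := by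
  rw [heatKernel, norm_mul, Complex.norm_exp]
  congr 2
  have : (-(‖x‖ : ℂ) ^ 2 / (4 * z)) = ((-(‖x‖ ^ 2 / 4) : ℝ) : ℂ) * z⁻¹ := by
    push_cast
    rw [div_eq_mul_inv, mul_inv]
    ring
  rw [this, Complex.re_ofReal_mul]
  ring

/-! ### Jointly smooth functions are of class `C^{2,1}` -/

lemma isC21On_of_contDiffOn {t₀ t₁ : ℝ} {u : ℝ → EuclideanSpace ℝ (Fin n) → ℂ}
    (h : ContDiffOn ℝ 2 (fun q : ℝ × EuclideanSpace ℝ (Fin n) => u q.1 q.2)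
      (Ioo t₀ t₁ ×ˢ univ)) : IsC21On t₀ t₁ u := by
  set F := fun q : ℝ × EuclideanSpace ℝ (Fin n) => u q.1 q.2 with hF
  have ho : IsOpen (Ioo t₀ t₁ ×ˢ (univ : Set (EuclideanSpace ℝ (Fin n)))) :=
    isOpen_Ioo.prod isOpen_univ
  have hmem : ∀ t ∈ Ioo t₀ t₁, ∀ x : EuclideanSpace ℝ (Fin n),
      (t, x) ∈ Ioo t₀ t₁ ×ˢ (univ : Set (EuclideanSpace ℝ (Fin n))) := fun t ht x => ⟨ht, trivial⟩
  have hat : ∀ t ∈ Ioo t₀ t₁, ∀ x, ContDiffAt ℝ 2 F (t, x) := fun t ht x =>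
    h.contDiffAt (ho.mem_nhds (hmem t ht x))
  have hd : ∀ t ∈ Ioo t₀ t₁, ∀ x, HasFDerivAt F (fderiv ℝ F (t, x)) (t, x) := fun t ht x =>
    ((hat t ht x).differentiableAt (by norm_num)).hasFDerivAt
  have h1 : ContDiffOn ℝ 1 (fderiv ℝ F) (Ioo t₀ t₁ ×ˢ univ) := h.fderiv_of_isOpen ho (by norm_num)
  have h2 : ContinuousOn (fderiv ℝ (fderiv ℝ F)) (Ioo t₀ t₁ ×ˢ univ) :=
    h1.continuousOn_fderiv_of_isOpen ho (by norm_num)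
  have htime : ∀ t ∈ Ioo t₀ t₁, ∀ x, HasDerivAt (fun s => u s x) (fderiv ℝ F (t, x) (1, 0)) t := by
    intro t ht x
    exact (hd t ht x).comp_hasDerivAt t ((hasDerivAt_id t).prodMk (hasDerivAt_const t x))
  have hsp : ∀ t ∈ Ioo t₀ t₁, ∀ x, HasFDerivAt (u t)
      ((fderiv ℝ F (t, x)).comp (ContinuousLinearMap.inr ℝ ℝ _)) x := by
    intro t ht x
    exact (hd t ht x).comp x (hasFDerivAt_prodMk_right t x)
  have hspsp : ∀ t ∈ Ioo t₀ t₁, ∀ x, HasFDerivAt (fderiv ℝ (u t))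
      (((ContinuousLinearMap.compL ℝ _ _ ℂ).flip (ContinuousLinearMap.inr ℝ ℝ _)).comp
        ((fderiv ℝ (fderiv ℝ F) (t, x)).comp
          (ContinuousLinearMap.inr ℝ ℝ (EuclideanSpace ℝ (Fin n))))) x := by
    intro t ht x
    have e : fderiv ℝ (u t) = fun x => ((ContinuousLinearMap.compL ℝ _ _ ℂ).flip
        (ContinuousLinearMap.inr ℝ ℝ _)) (fderiv ℝ F (t, x)) := by
      ext1 y
      exact (hsp t ht y).fderiv
    rw [e]
    refine (ContinuousLinearMap.hasFDerivAt _).comp x ?_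
    exact ((h1.contDiffAt (ho.mem_nhds (hmem t ht x))).differentiableAt
      (by norm_num)).hasFDerivAt.comp x (hasFDerivAt_prodMk_right t x)
  refine ⟨fun t ht => ?_, fun t ht x => (htime t ht x).differentiableAt, h.continuousOn,
    (h1.continuousOn.clm_apply (continuousOn_const (c := ((1 : ℝ), 0)))).congr
      fun q hq => (htime q.1 hq.1 q.2).deriv,
    (h1.continuousOn.clm_comp continuousOn_const).congr fun q hq => (hsp q.1 hq.1 q.2).fderiv,
    (continuousOn_const.clm_comp (h2.clm_comp continuousOn_const)).congr
      fun q hq => (hspsp q.1 hq.1 q.2).fderiv⟩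
  exact contDiff_iff_contDiffAt.2 fun x =>
    (hat t ht x).comp x (contDiffAt_const.prodMk contDiffAt_id)

/-! ### The heat kernel along an affine complex time. -/

section HeatFlow

variable {t₀ t₁ : ℝ} {α β : ℂ}

lemma contDiffOn_heatKernel (hz : ∀ t ∈ Ioo t₀ t₁, α + β * (t : ℝ) ∈ Complex.slitPlane)
    (b : EuclideanSpace ℝ (Fin n)) :
    ContDiffOn ℝ 2 (fun q : ℝ × EuclideanSpace ℝ (Fin n) => heatKernel (α + β * q.1) (q.2 - b))
      (Ioo t₀ t₁ ×ˢ univ) := by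
  have hzc : ContDiff ℝ 2 (fun q : ℝ × EuclideanSpace ℝ (Fin n) =>
      α + β * Complex.ofRealCLM q.1) := by fun_prop
  have hn : ContDiff ℝ 2 (fun q : ℝ × EuclideanSpace ℝ (Fin n) =>
      Complex.ofRealCLM (‖q.2 - b‖ ^ 2)) :=
    Complex.ofRealCLM.contDiff.comp ((contDiff_snd.sub contDiff_const).norm_sq ℝ)
  have h4 : ContDiffOn ℝ 2 (fun q : ℝ × EuclideanSpace ℝ (Fin n) =>
      Complex.exp (Complex.log (4 * Real.pi * (α + β * Complex.ofRealCLM q.1)) * (-(n : ℂ) / 2)) *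
        Complex.exp (-Complex.ofRealCLM (‖q.2 - b‖ ^ 2) / (4 * (α + β * Complex.ofRealCLM q.1))))
      (Ioo t₀ t₁ ×ˢ univ) := by
    intro q hq
    have hq' := hz q.1 hq.1
    refine ContDiffAt.contDiffWithinAt (ContDiffAt.mul ?_ ?_)
    · refine ContDiffAt.cexp (ContDiffAt.mul ?_ contDiffAt_const)
      exact ((Complex.contDiffAt_log (four_pi_mul_mem_slitPlane hq')).restrict_scalars ℝ).comp q
        (contDiffAt_const.mul hzc.contDiffAt)
    · refine ContDiffAt.cexp (hn.contDiffAt.neg.mul (ContDiffAt.inv (contDiffAt_const.mul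
        hzc.contDiffAt) ?_))
      simpa using Complex.slitPlane_ne_zero hq'
  refine h4.congr fun q hq => ?_
  rw [heatKernel, Complex.cpow_def_of_ne_zero
    (Complex.slitPlane_ne_zero (four_pi_mul_mem_slitPlane (hz q.1 hq.1)))]
  simp

lemma isC21On_heatKernel (hz : ∀ t ∈ Ioo t₀ t₁, α + β * (t : ℝ) ∈ Complex.slitPlane)
    (b : EuclideanSpace ℝ (Fin n)) :
    IsC21On t₀ t₁ (fun t x => heatKernel (α + β * t) (x - b)) :=
  isC21On_of_contDiffOn (contDiffOn_heatKernel hz b)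

/-- Both signs of β are needed: β = iħ/2m for the Schrödinger kernel, and β = -iκ with a complex
time of positive real part for the Gaussian solutions of the adjoint equation. -/
lemma deriv_heatKernel_eq (hz : ∀ t ∈ Ioo t₀ t₁, α + β * (t : ℝ) ∈ Complex.slitPlane)
    (b x : EuclideanSpace ℝ (Fin n)) {t : ℝ} (ht : t ∈ Ioo t₀ t₁) :
    deriv (fun s : ℝ => heatKernel (α + β * s) (x - b)) t =
      β * Laplacian.laplacian (fun x : EuclideanSpace ℝ (Fin n) => heatKernel (α + β * t) (x - b)) x := by
  have h1 : HasDerivAt (fun s : ℝ => α + β * (s : ℂ)) β t := by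
    simpa using ((Complex.ofRealCLM.hasDerivAt (x := t)).const_mul β).const_add α
  have h2 := (hasDerivAt_heatKernel (hz t ht) (x - b)).comp t h1
  have h3 : Laplacian.laplacian (fun x : EuclideanSpace ℝ (Fin n) => heatKernel (α + β * t) (x - b)) x =
      Laplacian.laplacian (heatKernel (α + β * t)) (x - b) := by
    have h4 : fderiv ℝ (fun x => heatKernel (α + β * t) (x - b)) =
        fun x => fderiv ℝ (heatKernel (α + β * t)) (x - b) := by
      ext1 y
      exact fderiv_comp_sub _
    rw [laplacian_eq_sum_fderiv_fderiv, laplacian_eq_sum_fderiv_fderiv, h4, fderiv_comp_sub]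
  rw [h3, laplacian_heatKernel (Complex.slitPlane_ne_zero (hz t ht)), mul_comm β]
  exact h2.deriv

end HeatFlow

/-! ### Gaussian integrals -/

lemma mem_slitPlane_of_re_pos {z : ℂ} (hz : 0 < z.re) : z ∈ Complex.slitPlane :=
  Complex.mem_slitPlane_iff.2 (Or.inl hz)

lemma ne_zero_of_re_pos {z : ℂ} (hz : 0 < z.re) : z ≠ 0 :=
  Complex.slitPlane_ne_zero (mem_slitPlane_of_re_pos hz)

lemma inv_re_pos {z : ℂ} (hz : 0 < z.re) : 0 < (z⁻¹).re := by
  rw [Complex.inv_re]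
  exact div_pos hz (Complex.normSq_pos.2 (ne_zero_of_re_pos hz))

/-- Both arguments lie in (-π/2, π/2), so their sum stays inside the principal range and no branch
jump occurs. -/
lemma mul_cpow_of_re_pos {x y : ℂ} (hx : 0 < x.re) (hy : 0 < y.re) (a : ℂ) :
    (x * y) ^ a = x ^ a * y ^ a := by
  have h1 := abs_lt.1 (Complex.abs_arg_lt_pi_div_two_iff.2 (Or.inl hx))
  have h2 := abs_lt.1 (Complex.abs_arg_lt_pi_div_two_iff.2 (Or.inl hy))
  have hx0 := ne_zero_of_re_pos hx
  have hy0 := ne_zero_of_re_pos hy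
  rw [Complex.cpow_def_of_ne_zero (mul_ne_zero hx0 hy0), Complex.cpow_def_of_ne_zero hx0,
    Complex.cpow_def_of_ne_zero hy0, Complex.log_mul hx0 hy0 ⟨by linarith, by linarith⟩, add_mul,
    Complex.exp_add]

lemma continuousOn_heatKernel :
    ContinuousOn (fun q : ℂ × EuclideanSpace ℝ (Fin n) => heatKernel q.1 q.2)
      (Complex.slitPlane ×ˢ univ) := by
  intro q hq
  refine ContinuousAt.continuousWithinAt (ContinuousAt.mul ?_ ?_)
  · exact ContinuousAt.comp (x := q) (f := fun q : ℂ × EuclideanSpace ℝ (Fin n) =>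
      4 * Real.pi * q.1) (continuousAt_cpow_const (four_pi_mul_mem_slitPlane hq.1)) (by fun_prop)
  · refine ContinuousAt.cexp (ContinuousAt.div (by fun_prop) (by fun_prop) ?_)
    simpa using Complex.slitPlane_ne_zero hq.1

lemma continuous_heatKernel (z : ℂ) :
    Continuous (heatKernel z : EuclideanSpace ℝ (Fin n) → ℂ) :=
  (contDiff_heatKernel z (k := 0)).continuous

lemma heatKernel_sub_comm (z : ℂ) (x y : EuclideanSpace ℝ (Fin n)) :
    heatKernel z (x - y) = heatKernel z (y - x) := by
  rw [heatKernel, heatKernel, norm_sub_rev]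

lemma conj_heatKernel {z : ℂ} (hz : 0 < z.re) (x : EuclideanSpace ℝ (Fin n)) :
    (starRingEnd ℂ) (heatKernel z x) = heatKernel ((starRingEnd ℂ) z) x := by
  have h1 : (4 * Real.pi * z).arg ≠ Real.pi :=
    (Complex.mem_slitPlane_iff_arg.1
      (four_pi_mul_mem_slitPlane (mem_slitPlane_of_re_pos hz))).1
  have h2 := Complex.conj_cpow (4 * Real.pi * z) (-(n : ℂ) / 2) h1
  simp only [map_mul, map_div₀, map_neg, Complex.conj_ofReal, map_ofNat, map_natCast] at h2
  rw [heatKernel, heatKernel, map_mul, h2, ← Complex.exp_conj]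
  simp [Complex.conj_ofNat]

lemma integrable_heatKernel {z : ℂ} (hz : 0 < z.re) :
    Integrable (heatKernel z : EuclideanSpace ℝ (Fin n) → ℂ) := by
  have h := GaussianFourier.integrable_cexp_neg_mul_sq_norm_add (b := (4 * z)⁻¹)
    (V := EuclideanSpace ℝ (Fin n)) (inv_re_pos (by simpa using hz)) 0 0
  refine (h.const_mul ((4 * Real.pi * z) ^ (-(n : ℂ) / 2))).congr (Eventually.of_forall fun x => ?_)
  simp only [heatKernel]
  congr 2
  rw [div_eq_mul_inv]
  ring

/-- Semigroup law at complex times. After translation by y the product is a Gaussian with quadratic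
coefficient b = 1/(4z) + 1/(4z') and a linear term, whose integral is explicit. The powers combine
because (4πz)(4πz') = (π/b)·4π(z+z') with all four factors in the right half-plane. -/
lemma integral_heatKernel_mul {z z' : ℂ} (hz : 0 < z.re) (hz' : 0 < z'.re)
    (y y' : EuclideanSpace ℝ (Fin n)) :
    ∫ x, heatKernel z (x - y) * heatKernel z' (x - y') = heatKernel (z + z') (y - y') := by
  have hz0 := ne_zero_of_re_pos hz
  have hz0' := ne_zero_of_re_pos hz'
  have hs : 0 < (z + z').re := by simpa using add_pos hz hz'
  have hs0 := ne_zero_of_re_pos hs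
  have hp : (Real.pi : ℂ) ≠ 0 := by exact_mod_cast Real.pi_ne_zero
  set b : ℂ := (4 * z)⁻¹ + (4 * z')⁻¹ with hb
  have hbre : 0 < b.re := by
    have h1 : 0 < ((4 * z)⁻¹).re := inv_re_pos (by simpa using hz)
    have h2 : 0 < ((4 * z')⁻¹).re := inv_re_pos (by simpa using hz')
    rw [hb, Complex.add_re]
    exact add_pos h1 h2
  have hb0 := ne_zero_of_re_pos hbre
  have hbeq : b = (z + z') / (4 * z * z') := by
    rw [hb]
    field_simp
    ring
  have hscale : ∀ w : ℂ, 0 < w.re → 0 < (4 * Real.pi * w).re := by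
    intro w hw
    have h : (4 * Real.pi * w : ℂ) = ((4 * Real.pi : ℝ) : ℂ) * w := by push_cast; ring
    rw [h, Complex.re_ofReal_mul]
    positivity
  have hpb : 0 < (Real.pi / b).re := by
    rw [div_eq_mul_inv, Complex.re_ofReal_mul]
    exact mul_pos Real.pi_pos (inv_re_pos hbre)
  have hpow : (4 * Real.pi * z) ^ (-(n : ℂ) / 2) * (4 * Real.pi * z') ^ (-(n : ℂ) / 2) *
      (Real.pi / b) ^ ((n : ℂ) / 2) = (4 * Real.pi * (z + z')) ^ (-(n : ℂ) / 2) := by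
    have h1 : (4 * Real.pi * z) * (4 * Real.pi * z') = (Real.pi / b) * (4 * Real.pi * (z + z')) := by
      rw [hbeq]
      field_simp
    rw [← mul_cpow_of_re_pos (hscale z hz) (hscale z' hz'), h1,
      mul_cpow_of_re_pos hpb (hscale _ hs), mul_right_comm, ← Complex.cpow_add _ _
      (ne_zero_of_re_pos hpb)]
    simp [neg_div]
  have h1 : ∀ v : EuclideanSpace ℝ (Fin n),
      heatKernel z (v + y - y) * heatKernel z' (v + y - y') =
      ((4 * Real.pi * z) ^ (-(n : ℂ) / 2) * (4 * Real.pi * z') ^ (-(n : ℂ) / 2) *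
        Complex.exp (-(‖y' - y‖ : ℂ) ^ 2 / (4 * z'))) *
      Complex.exp (-b * (‖v‖ : ℂ) ^ 2 + (2 * z')⁻¹ * (inner ℝ (y' - y) v : ℝ)) := by
    intro v
    have h2 : (‖v + y - y'‖ : ℂ) ^ 2 =
        (‖v‖ : ℂ) ^ 2 - 2 * (inner ℝ (y' - y) v : ℝ) + (‖y' - y‖ : ℂ) ^ 2 := by
      have := norm_sub_sq_real v (y' - y)
      rw [show v + y - y' = v - (y' - y) by abel, real_inner_comm]
      exact_mod_cast this
    rw [heatKernel, heatKernel, h2, add_sub_cancel_right]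
    have hexp : Complex.exp (-(‖v‖ : ℂ) ^ 2 / (4 * z)) * Complex.exp (-((‖v‖ : ℂ) ^ 2 -
        2 * (inner ℝ (y' - y) v : ℝ) + (‖y' - y‖ : ℂ) ^ 2) / (4 * z')) =
        Complex.exp (-(‖y' - y‖ : ℂ) ^ 2 / (4 * z')) *
        Complex.exp (-b * (‖v‖ : ℂ) ^ 2 + (2 * z')⁻¹ * (inner ℝ (y' - y) v : ℝ)) := by
      rw [← Complex.exp_add, ← Complex.exp_add, hb]
      congr 1
      field_simp
      ring
    linear_combination
      ((4 * Real.pi * z) ^ (-(n : ℂ) / 2) * (4 * Real.pi * z') ^ (-(n : ℂ) / 2)) * hexp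
  rw [← integral_add_right_eq_self _ y, integral_congr_ae (Eventually.of_forall h1),
    integral_const_mul, GaussianFourier.integral_cexp_neg_mul_sq_norm_add hbre,
    finrank_euclideanSpace_fin, heatKernel, ← hpow]
  have hexp : Complex.exp (-(‖y' - y‖ : ℂ) ^ 2 / (4 * z')) *
      Complex.exp ((2 * z')⁻¹ ^ 2 * (‖y' - y‖ : ℂ) ^ 2 / (4 * b)) =
      Complex.exp (-(‖y - y'‖ : ℂ) ^ 2 / (4 * (z + z'))) := by
    rw [← Complex.exp_add, norm_sub_rev y y', hbeq]
    congr 1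
    field_simp
    ring
  linear_combination ((4 * Real.pi * z) ^ (-(n : ℂ) / 2) * (4 * Real.pi * z') ^ (-(n : ℂ) / 2) *
    (Real.pi / b) ^ ((n : ℂ) / 2)) * hexp

/-- The heat kernel with small real time is an approximate identity. -/
lemma tendsto_integral_heatKernel_mul {f : EuclideanSpace ℝ (Fin n) → ℂ} (hf : Integrable f)
    {b : EuclideanSpace ℝ (Fin n)} (hb : ContinuousAt f b) :
    Tendsto (fun ε : ℝ => ∫ x, heatKernel (ε : ℂ) (x - b) * f x) (𝓝[>] 0) (𝓝 (f b)) := by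
  have h := Real.tendsto_integral_gaussian_smul' hf hb
  -- The Gaussian approximate identity has weight (πc)^{n/2} exp(-π²c|·|²) with c → ∞; the heat
  -- kernel at time ε corresponds to c = 1/(4π²ε).
  have h2 : Tendsto (fun ε : ℝ => (4 * Real.pi ^ 2)⁻¹ * ε⁻¹) (𝓝[>] 0) atTop :=
    tendsto_inv_nhdsGT_zero.const_mul_atTop (by positivity)
  refine (h.comp h2).congr' ?_
  filter_upwards [self_mem_nhdsWithin] with ε hε
  have hε : 0 < ε := hε
  have hp : (Real.pi : ℂ) ≠ 0 := by exact_mod_cast Real.pi_ne_zero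
  have hε0 : (ε : ℂ) ≠ 0 := by exact_mod_cast hε.ne'
  simp only [Function.comp_apply]
  refine integral_congr_ae (Eventually.of_forall fun x => ?_)
  simp only [smul_eq_mul, heatKernel, finrank_euclideanSpace_fin]
  congr 2
  · have h3 : (Real.pi * (((4 * Real.pi ^ 2)⁻¹ * ε⁻¹ : ℝ) : ℂ)) =
        (((4 * Real.pi * ε : ℝ)) : ℂ)⁻¹ := by
      push_cast
      field_simp
    have h4 : (4 * Real.pi * ε : ℂ) = ((4 * Real.pi * ε : ℝ) : ℂ) := by push_cast; ring
    rw [h3, h4, Complex.inv_cpow, neg_div, Complex.cpow_neg]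
    rw [Complex.arg_ofReal_of_nonneg (by positivity)]
    exact Real.pi_ne_zero.symm
  · congr 1
    rw [norm_sub_rev]
    push_cast
    field_simp

/-! ### The `L²` theory of the heat flow with complex time -/

/-- The function `x ↦ ∫ (4πz)^{-n/2} exp(-|x - y|²/(4z)) g(y) dy`. -/
noncomputable def heatFlow (g : EuclideanSpace ℝ (Fin n) → ℂ) (z : ℂ)
    (x : EuclideanSpace ℝ (Fin n)) : ℂ :=
  ∫ y, heatKernel z (x - y) * g y

/-- The Gaussian sesquilinear form `∬ g(y) conj(g(y')) (4πs)^{-n/2} exp(-|y - y'|²/(4s)) dy dy'`. -/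
noncomputable def gaussForm (g : EuclideanSpace ℝ (Fin n) → ℂ) (s : ℂ) : ℂ :=
  ∫ p : EuclideanSpace ℝ (Fin n) × EuclideanSpace ℝ (Fin n),
    g p.1 * (starRingEnd ℂ) (g p.2) * heatKernel s (p.1 - p.2)

lemma norm_heatKernel_le {z : ℂ} (hz : 0 < z.re) (x : EuclideanSpace ℝ (Fin n)) :
    ‖heatKernel z x‖ ≤ ‖(4 * Real.pi * z : ℂ) ^ (-(n : ℂ) / 2)‖ := by
  rw [norm_heatKernel]
  refine mul_le_of_le_one_right (norm_nonneg _) (Real.exp_le_one_iff.2 ?_)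
  have := inv_re_pos hz
  nlinarith [sq_nonneg ‖x‖]

lemma integral_norm_heatKernel {s : ℝ} (hs : 0 < s) :
    ∫ x : EuclideanSpace ℝ (Fin n), ‖heatKernel (s : ℂ) x‖ = 1 := by
  have h4 : (4 * Real.pi * s : ℂ) = ((4 * Real.pi * s : ℝ) : ℂ) := by push_cast; ring
  have h5 : (-(n : ℂ) / 2) = ((-(n : ℝ) / 2 : ℝ) : ℂ) := by push_cast; ring
  have hp := Real.pi_pos
  have h6 : 0 < 4 * Real.pi * s := by positivity
  have hb : 0 < ((s : ℂ)⁻¹).re / 4 := by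
    rw [← Complex.ofReal_inv, Complex.ofReal_re]
    positivity
  have h7 : Real.pi / (((s : ℂ)⁻¹).re / 4) = 4 * Real.pi * s := by
    rw [← Complex.ofReal_inv, Complex.ofReal_re]
    field_simp
  simp only [norm_heatKernel]
  rw [integral_const_mul, GaussianFourier.integral_rexp_neg_mul_sq_norm hb, h7, h4, h5,
    Complex.norm_cpow_real, Complex.norm_real, Real.norm_of_nonneg h6.le,
    finrank_euclideanSpace_fin, ← Real.rpow_add h6]
  simp [neg_div]

lemma enorm_add_add_sq_le (a b c : ℂ) :
    ‖a + b + c‖ₑ ^ 2 ≤ 3 * (‖a‖ₑ ^ 2 + ‖b‖ₑ ^ 2 + ‖c‖ₑ ^ 2) := by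
  have h3 : (3 : ENNReal) = ENNReal.ofReal 3 := by norm_num
  simp only [← ofReal_norm, ← ENNReal.ofReal_pow (norm_nonneg _)]
  rw [← ENNReal.ofReal_add (by positivity) (by positivity),
    ← ENNReal.ofReal_add (by positivity) (by positivity), h3, ← ENNReal.ofReal_mul (by norm_num)]
  refine ENNReal.ofReal_le_ofReal ?_
  have h := norm_add₃_le (a := a) (b := b) (c := c)
  calc ‖a + b + c‖ ^ 2 ≤ (‖a‖ + ‖b‖ + ‖c‖) ^ 2 := by gcongr
    _ ≤ _ := by nlinarith [sq_nonneg (‖a‖ - ‖b‖), sq_nonneg (‖b‖ - ‖c‖), sq_nonneg (‖a‖ - ‖c‖)]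

/-- Fatou's lemma for squares of norms. -/
lemma lintegral_enorm_sq_le_of_tendsto {X ι : Type*} [MeasurableSpace X] {μ : Measure X}
    {l : Filter ι} [l.IsCountablyGenerated] [l.NeBot] {F : ι → X → ℂ} {f : X → ℂ} {C : ENNReal}
    (hF : ∀ i, Measurable (F i)) (hlim : ∀ x, Tendsto (fun i => F i x) l (𝓝 (f x)))
    (hC : ∀ᶠ i in l, ∫⁻ x, ‖F i x‖ₑ ^ 2 ∂μ ≤ C) : ∫⁻ x, ‖f x‖ₑ ^ 2 ∂μ ≤ C := by
  calc ∫⁻ x, ‖f x‖ₑ ^ 2 ∂μ = ∫⁻ x, liminf (fun i => ‖F i x‖ₑ ^ 2) l ∂μ := by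
        refine lintegral_congr fun x => ?_
        exact (((ENNReal.continuous_pow 2).tendsto _).comp (hlim x).enorm).liminf_eq.symm
    _ ≤ liminf (fun i => ∫⁻ x, ‖F i x‖ₑ ^ 2 ∂μ) l :=
        lintegral_liminf_le fun i => (hF i).enorm.pow_const 2
    _ ≤ C := liminf_le_of_frequently_le' hC.frequently

lemma lintegral_enorm_sq_eq {X : Type*} [MeasurableSpace X] {μ : Measure X} {h : X → ℂ}
    (hi : Integrable (fun x => h x * (starRingEnd ℂ) (h x)) μ) :
    ∫⁻ x, ‖h x‖ₑ ^ 2 ∂μ = ENNReal.ofReal (∫ x, h x * (starRingEnd ℂ) (h x) ∂μ).re := by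
  have e : ∀ x, h x * (starRingEnd ℂ) (h x) = ((‖h x‖ ^ 2 : ℝ) : ℂ) := fun x => by
    rw [Complex.mul_conj, Complex.normSq_eq_norm_sq]
  simp only [e] at hi ⊢
  have hi' : Integrable (fun x => ‖h x‖ ^ 2) μ :=
    hi.re.congr (Eventually.of_forall fun x => Complex.ofReal_re _)
  have hr : (∫ x, ((‖h x‖ ^ 2 : ℝ) : ℂ) ∂μ) = ((∫ x, ‖h x‖ ^ 2 ∂μ : ℝ) : ℂ) := integral_ofReal
  rw [hr, Complex.ofReal_re, ofReal_integral_eq_lintegral_ofReal hi'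
    (Eventually.of_forall fun x => by positivity)]
  refine lintegral_congr fun x => ?_
  rw [← ofReal_norm, ENNReal.ofReal_pow (norm_nonneg _)]

lemma heatFlow_mul_conj_eq (g : EuclideanSpace ℝ (Fin n) → ℂ) (z z' : ℂ)
    (x : EuclideanSpace ℝ (Fin n)) :
    heatFlow g z x * (starRingEnd ℂ) (heatFlow g z' x) =
      ∫ p : EuclideanSpace ℝ (Fin n) × EuclideanSpace ℝ (Fin n),
        (heatKernel z (x - p.1) * g p.1) * (starRingEnd ℂ) (heatKernel z' (x - p.2) * g p.2) := by
  rw [heatFlow, heatFlow, ← integral_conj]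
  exact (integral_prod_mul _ _).symm

section

variable {g : EuclideanSpace ℝ (Fin n) → ℂ} (hg : Continuous g) (hc : HasCompactSupport g)
include hg hc

/-- Compact support of g gives continuity on the whole slit plane, including imaginary times, where
the kernel has no decay. -/
lemma continuousOn_heatFlow :
    ContinuousOn (fun q : ℂ × EuclideanSpace ℝ (Fin n) => heatFlow g q.1 q.2)
      (Complex.slitPlane ×ˢ univ) := by
  refine continuousOn_integral_of_compact_support (k := tsupport g) hc ?_ ?_
  · refine ContinuousOn.mul ?_ (hg.comp continuous_snd).continuousOn
    refine continuousOn_heatKernel.comp (f := fun p : (ℂ × EuclideanSpace ℝ (Fin n)) ×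
      EuclideanSpace ℝ (Fin n) => (p.1.1, p.1.2 - p.2)) (by fun_prop) ?_
    exact fun p hp => ⟨hp.1.1, trivial⟩
  · intro p y _ hy
    rw [image_eq_zero_of_notMem_tsupport hy, mul_zero]

lemma continuous_heatFlow (z : ℂ) : Continuous (heatFlow g z) := by
  rw [← continuousOn_univ]
  refine continuousOn_integral_of_compact_support (k := tsupport g) hc ?_ ?_
  · refine Continuous.continuousOn (Continuous.mul ?_ (hg.comp continuous_snd))
    exact (continuous_heatKernel z).comp (by fun_prop)
  · intro p y _ hy
    rw [image_eq_zero_of_notMem_tsupport hy, mul_zero]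

lemma continuousOn_gaussForm : ContinuousOn (gaussForm g) Complex.slitPlane := by
  refine continuousOn_integral_of_compact_support (k := tsupport g ×ˢ tsupport g)
    (IsCompact.prod hc hc) ?_ ?_
  · refine ContinuousOn.mul (Continuous.continuousOn ?_) ?_
    · exact (hg.comp (by fun_prop)).mul (Complex.continuous_conj.comp (hg.comp (by fun_prop)))
    · refine continuousOn_heatKernel.comp (f := fun p : ℂ × (EuclideanSpace ℝ (Fin n) ×
        EuclideanSpace ℝ (Fin n)) => (p.1, p.2.1 - p.2.2)) (by fun_prop) ?_
      exact fun p hp => ⟨hp.1, trivial⟩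
  · intro p y _ hy
    rw [mem_prod, not_and_or] at hy
    rcases hy with hy | hy <;> simp [image_eq_zero_of_notMem_tsupport hy]

/-- This justifies Fubini below. One kernel factor provides integrability in x, as in a convolution;
the other enters only through its sup bound. -/
lemma integrable_heatFlow_mul_conj_integrand {z z' : ℂ} (hz : 0 < z.re) (hz' : 0 < z'.re) :
    Integrable (fun q : EuclideanSpace ℝ (Fin n) ×
        (EuclideanSpace ℝ (Fin n) × EuclideanSpace ℝ (Fin n)) =>
      (heatKernel z (q.1 - q.2.1) * g q.2.1) *
        (starRingEnd ℂ) (heatKernel z' (q.1 - q.2.2) * g q.2.2)) (volume.prod volume) := by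
  have hgi : Integrable g := hg.integrable_of_hasCompactSupport hc
  have h1 : Integrable (fun p : EuclideanSpace ℝ (Fin n) × EuclideanSpace ℝ (Fin n) =>
      heatKernel z (p.1 - p.2) * g p.2) (volume.prod volume) :=
    (hgi.convolution_integrand (ContinuousLinearMap.mul ℝ ℂ) (integrable_heatKernel hz)).congr
      (Eventually.of_forall fun p => by simp [mul_comm])
  have h2 : Integrable (fun p => (starRingEnd ℂ) (g p)) :=
    (Complex.conjCLE.toContinuousLinearMap.integrable_comp hgi)
  have h3 := h1.mul_prod h2
  have h4 := ((measurePreserving_prodAssoc (volume : Measure (EuclideanSpace ℝ (Fin n)))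
    (volume : Measure (EuclideanSpace ℝ (Fin n)))
    (volume : Measure (EuclideanSpace ℝ (Fin n)))).symm).integrable_comp_of_integrable h3
  have h5 : Continuous fun q : EuclideanSpace ℝ (Fin n) ×
        (EuclideanSpace ℝ (Fin n) × EuclideanSpace ℝ (Fin n)) =>
      (starRingEnd ℂ) (heatKernel z' (q.1 - q.2.2)) :=
    Complex.continuous_conj.comp ((continuous_heatKernel z').comp (by fun_prop))
  have h6 := h4.mul_bdd (c := ‖(4 * Real.pi * z' : ℂ) ^ (-(n : ℂ) / 2)‖)
    h5.aestronglyMeasurable (Eventually.of_forall fun q => by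
      simpa using norm_heatKernel_le hz' (q.1 - q.2.2))
  refine h6.congr (Eventually.of_forall fun q => ?_)
  simp [MeasurableEquiv.prodAssoc]
  ring

lemma integrable_heatFlow_mul_conj {z z' : ℂ} (hz : 0 < z.re) (hz' : 0 < z'.re) :
    Integrable (fun x => heatFlow g z x * (starRingEnd ℂ) (heatFlow g z' x)) := by
  simp only [heatFlow_mul_conj_eq]
  exact (integrable_heatFlow_mul_conj_integrand hg hc hz hz').integral_prod_left

/-- Integrate in x first and apply the semigroup law. For z = z' only 2 Re z survives on the right,
so the L² norm does not see the imaginary part: this takes the place of Plancherel's theorem. -/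
lemma integral_heatFlow_mul_conj {z z' : ℂ} (hz : 0 < z.re) (hz' : 0 < z'.re) :
    ∫ x, heatFlow g z x * (starRingEnd ℂ) (heatFlow g z' x) =
      gaussForm g (z + (starRingEnd ℂ) z') := by
  simp only [heatFlow_mul_conj_eq]
  rw [integral_integral_swap (integrable_heatFlow_mul_conj_integrand hg hc hz hz'), gaussForm]
  refine integral_congr_ae (Eventually.of_forall fun p => ?_)
  simp only
  rw [← integral_heatKernel_mul hz (by simpa using hz'), ← integral_const_mul]
  refine integral_congr_ae (Eventually.of_forall fun x => ?_)
  simp only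
  rw [map_mul, conj_heatKernel hz']
  ring

lemma lintegral_heatFlow_sq {z : ℂ} (hz : 0 < z.re) :
    ∫⁻ x, ‖heatFlow g z x‖ₑ ^ 2 = ENNReal.ofReal (gaussForm g ((2 * z.re : ℝ) : ℂ)).re := by
  rw [lintegral_enorm_sq_eq (integrable_heatFlow_mul_conj hg hc hz hz),
    integral_heatFlow_mul_conj hg hc hz hz, Complex.add_conj]

lemma lintegral_heatFlow_sub_sq {z z' : ℂ} (hz : 0 < z.re) (hz' : 0 < z'.re) :
    ∫⁻ x, ‖heatFlow g z x - heatFlow g z' x‖ₑ ^ 2 =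
      ENNReal.ofReal (gaussForm g (z + (starRingEnd ℂ) z) - gaussForm g (z + (starRingEnd ℂ) z')
        - gaussForm g (z' + (starRingEnd ℂ) z) + gaussForm g (z' + (starRingEnd ℂ) z')).re := by
  have e : ∀ x, (heatFlow g z x - heatFlow g z' x) *
      (starRingEnd ℂ) (heatFlow g z x - heatFlow g z' x) =
      heatFlow g z x * (starRingEnd ℂ) (heatFlow g z x)
      - heatFlow g z x * (starRingEnd ℂ) (heatFlow g z' x)
      - heatFlow g z' x * (starRingEnd ℂ) (heatFlow g z x)
      + heatFlow g z' x * (starRingEnd ℂ) (heatFlow g z' x) := fun x => by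
    rw [map_sub]
    ring
  have i1 := integrable_heatFlow_mul_conj hg hc hz hz
  have i2 := integrable_heatFlow_mul_conj hg hc hz hz'
  have i3 := integrable_heatFlow_mul_conj hg hc hz' hz
  have i4 := integrable_heatFlow_mul_conj hg hc hz' hz'
  have i12 : Integrable (fun x => heatFlow g z x * (starRingEnd ℂ) (heatFlow g z x)
      - heatFlow g z x * (starRingEnd ℂ) (heatFlow g z' x)) := i1.sub i2
  have i123 : Integrable (fun x => heatFlow g z x * (starRingEnd ℂ) (heatFlow g z x)
      - heatFlow g z x * (starRingEnd ℂ) (heatFlow g z' x)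
      - heatFlow g z' x * (starRingEnd ℂ) (heatFlow g z x)) := i12.sub i3
  rw [lintegral_enorm_sq_eq]
  · simp only [e]
    rw [integral_add i123 i4, integral_sub i12 i3, integral_sub i1 i2,
      integral_heatFlow_mul_conj hg hc hz hz, integral_heatFlow_mul_conj hg hc hz hz',
      integral_heatFlow_mul_conj hg hc hz' hz, integral_heatFlow_mul_conj hg hc hz' hz']
  · simp only [e]
    exact i123.add i4

lemma tendsto_heatFlow_real (x : EuclideanSpace ℝ (Fin n)) :
    Tendsto (fun ε : ℝ => heatFlow g (ε : ℂ) x) (𝓝[>] 0) (𝓝 (g x)) := by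
  refine (tendsto_integral_heatKernel_mul (hg.integrable_of_hasCompactSupport hc)
    hg.continuousAt).congr fun ε => ?_
  rw [heatFlow]
  simp only [heatKernel_sub_comm _ x]

/-- At real times the kernel has L¹ norm 1, so a sup bound on g is preserved. It serves as a
dominating constant in `tendsto_gaussForm`. -/
lemma exists_norm_heatFlow_real_le : ∃ M, ∀ s : ℝ, 0 < s → ∀ x, ‖heatFlow g (s : ℂ) x‖ ≤ M := by
  obtain ⟨M, hM⟩ := hg.bounded_above_of_compact_support hc
  refine ⟨M, fun s hs x => ?_⟩
  have hi : Integrable (fun y => heatKernel (s : ℂ) (x - y)) :=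
    (integrable_heatKernel (by simpa using hs)).comp_sub_left x
  calc ‖heatFlow g (s : ℂ) x‖ ≤ ∫ y, ‖heatKernel (s : ℂ) (x - y)‖ * M := by
        refine norm_integral_le_of_norm_le (hi.norm.mul_const M) (Eventually.of_forall fun y => ?_)
        rw [norm_mul]
        gcongr
        exact hM y
    _ = M := by
        rw [integral_mul_const, integral_sub_left_eq_self (fun y => ‖heatKernel (s : ℂ) y‖),
          integral_norm_heatKernel hs, one_mul]

/-- By Fubini, at real s the form is the inner product of the flow of g at time s with g itself, and
the flow converges pointwise and boundedly to g. -/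
lemma tendsto_gaussForm :
    Tendsto (fun s : ℝ => gaussForm g s) (𝓝[>] 0) (𝓝 (∫ x, g x * (starRingEnd ℂ) (g x))) := by
  obtain ⟨M, hM⟩ := exists_norm_heatFlow_real_le hg hc
  have hgi : Integrable g := hg.integrable_of_hasCompactSupport hc
  have h2 : Integrable (fun p => (starRingEnd ℂ) (g p)) :=
    (Complex.conjCLE.toContinuousLinearMap.integrable_comp hgi)
  have h1 : Tendsto (fun s : ℝ => ∫ x, heatFlow g (s : ℂ) x * (starRingEnd ℂ) (g x)) (𝓝[>] 0)
      (𝓝 (∫ x, g x * (starRingEnd ℂ) (g x))) := by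
    refine tendsto_integral_filter_of_dominated_convergence (fun x => M * ‖g x‖) ?_ ?_
      (hgi.norm.const_mul M) ?_
    · exact Eventually.of_forall fun s => ((continuous_heatFlow hg hc s).mul
        (Complex.continuous_conj.comp hg)).aestronglyMeasurable
    · filter_upwards [self_mem_nhdsWithin] with s hs
      refine Eventually.of_forall fun x => ?_
      rw [norm_mul, RCLike.norm_conj]
      gcongr
      exact hM s hs x
    · exact Eventually.of_forall fun x => (tendsto_heatFlow_real hg hc x).mul_const _
  refine h1.congr' ?_
  filter_upwards [self_mem_nhdsWithin] with s hs
  have hs : 0 < s := hs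
  have hint : Integrable (fun p : EuclideanSpace ℝ (Fin n) × EuclideanSpace ℝ (Fin n) =>
      g p.1 * (starRingEnd ℂ) (g p.2) * heatKernel (s : ℂ) (p.1 - p.2)) (volume.prod volume) := by
    refine (hgi.mul_prod h2).mul_bdd (c := ‖(4 * Real.pi * s : ℂ) ^ (-(n : ℂ) / 2)‖) ?_
      (Eventually.of_forall fun q => norm_heatKernel_le (by simpa using hs) _)
    exact ((continuous_heatKernel _).comp (by fun_prop)).aestronglyMeasurable
  rw [gaussForm, Measure.volume_eq_prod, integral_prod_symm _ hint]
  refine integral_congr_ae (Eventually.of_forall fun x => ?_)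
  simp only
  rw [heatFlow, ← integral_mul_const]
  refine integral_congr_ae (Eventually.of_forall fun y => ?_)
  simp only
  rw [heatKernel_sub_comm]
  ring

/-- Expanding the square gives `gaussForm` at 2ε, 2ε+η (twice, with a minus sign) and 2ε+2η. All are
near ‖g‖², and 1 - 2 + 1 = 0. Since τ cancels in these arguments, δ does not depend on τ. Each of
the four terms costs e/4. -/
lemma exists_lintegral_heatFlow_sub_le {e : ℝ} (he : 0 < e) :
    ∃ δ > 0, ∀ ε η τ : ℝ, 0 < ε → 0 < η → ε < δ → η < δ →
      ∫⁻ x, ‖heatFlow g (ε + Complex.I * τ) x - heatFlow g (ε + η + Complex.I * τ) x‖ₑ ^ 2 ≤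
        ENNReal.ofReal e := by
  set N := ∫ x, g x * (starRingEnd ℂ) (g x)
  have h := Metric.tendsto_nhdsWithin_nhds.1 (tendsto_gaussForm hg hc) (e / 4) (by positivity)
  obtain ⟨δ, hδ, h⟩ := h
  have h' : ∀ s : ℝ, 0 < s → s < δ → |(gaussForm g s).re - N.re| < e / 4 := fun s hs hs' => by
    have h1 := h (x := s) hs (by rwa [Real.dist_eq, sub_zero, abs_of_pos hs])
    rw [dist_eq_norm] at h1
    rw [← Complex.sub_re]
    exact (Complex.abs_re_le_norm _).trans_lt h1
  -- The quarter keeps the largest argument 2ε+2η below δ.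
  refine ⟨δ / 4, by positivity, fun ε η τ hε hη hε' hη' => ?_⟩
  have e1 : (ε + Complex.I * τ : ℂ) + (starRingEnd ℂ) (ε + Complex.I * τ) = ((2 * ε : ℝ) : ℂ) := by
    simp; ring
  have e2 : (ε + Complex.I * τ : ℂ) + (starRingEnd ℂ) (ε + η + Complex.I * τ) =
      ((2 * ε + η : ℝ) : ℂ) := by simp; ring
  have e3 : (ε + η + Complex.I * τ : ℂ) + (starRingEnd ℂ) (ε + Complex.I * τ) =
      ((2 * ε + η : ℝ) : ℂ) := by simp; ring
  have e4 : (ε + η + Complex.I * τ : ℂ) + (starRingEnd ℂ) (ε + η + Complex.I * τ) =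
      ((2 * ε + 2 * η : ℝ) : ℂ) := by simp; ring
  rw [lintegral_heatFlow_sub_sq hg hc (by simpa using hε) (by simpa using add_pos hε hη),
    e1, e2, e3, e4]
  refine ENNReal.ofReal_le_ofReal ?_
  have a1 := abs_lt.1 (h' (2 * ε) (by linarith) (by linarith))
  have a2 := abs_lt.1 (h' (2 * ε + η) (by linarith) (by linarith))
  have a3 := abs_lt.1 (h' (2 * ε + 2 * η) (by linarith) (by linarith))
  simp only [Complex.add_re, Complex.sub_re]
  linarith [a1.1, a1.2, a2.1, a2.2, a3.1, a3.2]

lemma tendsto_heatFlow_add_I {τ : ℝ} (hτ : τ ≠ 0) (η : ℝ)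
    (x : EuclideanSpace ℝ (Fin n)) :
    Tendsto (fun ε : ℝ => heatFlow g (ε + η + Complex.I * τ) x) (𝓝[>] 0)
      (𝓝 (heatFlow g (η + Complex.I * τ) x)) := by
  have h1 : (η + Complex.I * τ : ℂ) ∈ Complex.slitPlane :=
    Complex.mem_slitPlane_iff.2 (Or.inr (by simpa using hτ))
  have h2 : ContinuousAt (fun z => heatFlow g z x) (η + Complex.I * τ : ℂ) := by
    have := (continuousOn_heatFlow hg hc).continuousAt (x := (η + Complex.I * τ, x))
      ((Complex.isOpen_slitPlane.prod isOpen_univ).mem_nhds ⟨h1, trivial⟩)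
    exact this.comp (f := fun z => (z, x)) (by fun_prop)
  have h3 : Tendsto (fun ε : ℝ => (ε + η + Complex.I * τ : ℂ)) (𝓝[>] 0)
      (𝓝 (η + Complex.I * τ : ℂ)) := by
    have : Continuous (fun ε : ℝ => (ε + η + Complex.I * τ : ℂ)) := by fun_prop
    simpa using (this.tendsto 0).mono_left nhdsWithin_le_nhds
  exact h2.tendsto.comp h3

/-- The free Schrödinger flow is bounded in `L²`. -/
lemma exists_lintegral_heatFlow_I_le :
    ∃ C : ENNReal, C < ⊤ ∧ ∀ τ : ℝ, τ ≠ 0 →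
      ∫⁻ x, ‖heatFlow g (Complex.I * τ) x‖ₑ ^ 2 ≤ C := by
  set N := ∫ x, g x * (starRingEnd ℂ) (g x)
  -- The slack 1 is needed because the norms at ε + iτ are only known to converge to `N.re` as ε →
  -- 0; Fatou's lemma needs just an eventual bound.
  refine ⟨ENNReal.ofReal (N.re + 1), ENNReal.ofReal_lt_top, fun τ hτ => ?_⟩
  refine lintegral_enorm_sq_le_of_tendsto (l := 𝓝[>] (0 : ℝ))
    (F := fun ε : ℝ => heatFlow g (ε + Complex.I * τ))
    (fun ε => (continuous_heatFlow hg hc _).measurable)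
    (fun x => by simpa using tendsto_heatFlow_add_I hg hc hτ 0 x) ?_
  have h1 : Tendsto (fun ε : ℝ => 2 * ε) (𝓝[>] 0) (𝓝[>] 0) := by
    refine tendsto_nhdsWithin_iff.2 ⟨?_, ?_⟩
    · exact ((continuous_const.mul continuous_id).tendsto' (0 : ℝ) 0 (by simp)).mono_left
        nhdsWithin_le_nhds
    · filter_upwards [self_mem_nhdsWithin] with ε hε
      exact mul_pos two_pos (mem_Ioi.1 hε)
  have h2 := ((Complex.continuous_re.tendsto _).comp ((tendsto_gaussForm hg hc).comp h1))
  filter_upwards [h2.eventually_le_const (lt_add_one N.re), self_mem_nhdsWithin] with ε hε hε'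
  rw [lintegral_heatFlow_sq hg hc (by simpa using hε')]
  refine ENNReal.ofReal_le_ofReal ?_
  simpa using hε

/-- The free Schrödinger flow is continuous in `L²` at time `0`. -/
lemma tendsto_lintegral_heatFlow_I_sub :
    Tendsto (fun τ : ℝ => ∫⁻ x, ‖heatFlow g (Complex.I * τ) x - g x‖ₑ ^ 2) (𝓝[>] 0) (𝓝 0) := by
  rw [ENNReal.tendsto_nhds_zero]
  intro ε₀ hε₀
  obtain ⟨r, hr0, hr⟩ := ENNReal.lt_iff_exists_nnreal_btwn.1 hε₀
  have hr0 : 0 < r := by simpa using hr0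
  -- Three differences of size e, times the constant 3 of `enorm_add_add_sq_le`, add up to r.
  set e : ℝ := r / 9 with he_def
  have he : 0 < e := by positivity
  obtain ⟨δ, hδ, h⟩ := exists_lintegral_heatFlow_sub_le hg hc he
  set η := δ / 2 with hη_def
  have hη : 0 < η := by positivity
  have hηδ : η < δ := by simp only [hη_def]; linarith
  have hsmall : ∀ᶠ ε : ℝ in 𝓝[>] 0, 0 < ε ∧ ε < δ := by
    filter_upwards [Ioo_mem_nhdsGT hδ] with ε hε using hε
  -- The path from iτ to 0 goes through η + iτ and η: `hA` smooths at time τ, uniformly in τ; `hC`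
  -- moves along the line Re z = η, where `gaussForm` is continuous; `hB` removes the smoothing at τ
  -- = 0.
  have hA : ∀ τ : ℝ, τ ≠ 0 → ∫⁻ x, ‖heatFlow g (Complex.I * τ) x -
      heatFlow g (η + Complex.I * τ) x‖ₑ ^ 2 ≤ ENNReal.ofReal e := by
    intro τ hτ
    refine lintegral_enorm_sq_le_of_tendsto (l := 𝓝[>] (0 : ℝ))
      (F := fun ε : ℝ => fun x => heatFlow g (ε + Complex.I * τ) x -
        heatFlow g (ε + η + Complex.I * τ) x)
      (fun ε => ((continuous_heatFlow hg hc _).sub (continuous_heatFlow hg hc _)).measurable)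
      (fun x => ?_) ?_
    · exact Tendsto.sub (by simpa using tendsto_heatFlow_add_I hg hc hτ 0 x)
        (tendsto_heatFlow_add_I hg hc hτ η x)
    · filter_upwards [hsmall] with ε hε using h ε η τ hε.1 hη hε.2 hηδ
  have hB : ∫⁻ x, ‖heatFlow g (η : ℂ) x - g x‖ₑ ^ 2 ≤ ENNReal.ofReal e := by
    refine lintegral_enorm_sq_le_of_tendsto (l := 𝓝[>] (0 : ℝ))
      (F := fun ε : ℝ => fun x => heatFlow g (ε + η : ℂ) x - heatFlow g (ε : ℂ) x)
      (fun ε => ((continuous_heatFlow hg hc _).sub (continuous_heatFlow hg hc _)).measurable)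
      (fun x => ?_) ?_
    · refine Tendsto.sub ?_ (tendsto_heatFlow_real hg hc x)
      have h1 : (η : ℂ) ∈ Complex.slitPlane :=
        Complex.mem_slitPlane_iff.2 (Or.inl (by simpa using hη))
      have h2 : ContinuousAt (fun z => heatFlow g z x) (η : ℂ) := by
        have := (continuousOn_heatFlow hg hc).continuousAt (x := ((η : ℂ), x))
          ((Complex.isOpen_slitPlane.prod isOpen_univ).mem_nhds ⟨h1, trivial⟩)
        exact this.comp (f := fun z => (z, x)) (by fun_prop)
      refine h2.tendsto.comp ?_
      have : Continuous (fun ε : ℝ => (ε + η : ℂ)) := by fun_prop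
      simpa using (this.tendsto 0).mono_left nhdsWithin_le_nhds
    · filter_upwards [hsmall] with ε hε
      have := h ε η 0 hε.1 hη hε.2 hηδ
      simp only [Complex.ofReal_zero, mul_zero, add_zero] at this
      simpa only [enorm_sub_rev] using this
  have hC : ∀ᶠ τ : ℝ in 𝓝[>] 0, ∫⁻ x, ‖heatFlow g (η + Complex.I * τ) x -
      heatFlow g (η : ℂ) x‖ₑ ^ 2 ≤ ENNReal.ofReal e := by
    have hre : ∀ τ : ℝ, 0 < (η + Complex.I * τ : ℂ).re := fun τ => by simpa using hη
    have hcont : ContinuousOn (gaussForm g) {z | 0 < z.re} :=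
      (continuousOn_gaussForm hg hc).mono fun z hz => mem_slitPlane_of_re_pos hz
    have ho : IsOpen {z : ℂ | 0 < z.re} := isOpen_lt continuous_const Complex.continuous_re
    have hk : ∀ k : ℝ → ℂ, Continuous k → (∀ τ, 0 < (k τ).re) →
        Continuous (fun τ => gaussForm g (k τ)) := fun k hk hk' =>
      hcont.comp_continuous hk hk'
    have h1 : Continuous fun τ : ℝ => (gaussForm g ((η + Complex.I * τ : ℂ) +
        (starRingEnd ℂ) (η + Complex.I * τ)) - gaussForm g ((η + Complex.I * τ : ℂ) +
        (starRingEnd ℂ) (η : ℂ)) - gaussForm g ((η : ℂ) + (starRingEnd ℂ) (η + Complex.I * τ))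
        + gaussForm g ((η : ℂ) + (starRingEnd ℂ) (η : ℂ))).re := by
      refine Complex.continuous_re.comp ((((hk _ ?_ ?_).sub (hk _ ?_ ?_)).sub (hk _ ?_ ?_)).add
        (hk _ ?_ ?_))
      any_goals intro τ; simp [hη]
      all_goals first
        | exact Continuous.add (by fun_prop) (Complex.continuous_conj.comp (by fun_prop))
    have h2 := (h1.tendsto' 0 0 (by simp)).mono_left (nhdsWithin_le_nhds (s := Ioi 0))
    filter_upwards [h2.eventually_le_const he] with τ hτ
    rw [lintegral_heatFlow_sub_sq hg hc (hre τ) (by simpa using hη)]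
    exact ENNReal.ofReal_le_ofReal hτ
  filter_upwards [hC, self_mem_nhdsWithin] with τ hCτ hτ
  have hm : ∀ z z', Measurable fun x => ‖heatFlow g z x - heatFlow g z' x‖ₑ ^ 2 := fun z z' =>
    ((continuous_heatFlow hg hc z).sub (continuous_heatFlow hg hc z')).measurable.enorm.pow_const 2
  calc ∫⁻ x, ‖heatFlow g (Complex.I * τ) x - g x‖ₑ ^ 2
      ≤ ∫⁻ x, 3 * (‖heatFlow g (Complex.I * τ) x - heatFlow g (η + Complex.I * τ) x‖ₑ ^ 2 +
        ‖heatFlow g (η + Complex.I * τ) x - heatFlow g (η : ℂ) x‖ₑ ^ 2 +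
        ‖heatFlow g (η : ℂ) x - g x‖ₑ ^ 2) := by
        refine lintegral_mono fun x => ?_
        refine le_trans (le_of_eq ?_) (enorm_add_add_sq_le _ _ _)
        congr 2
        ring
    _ ≤ 3 * (ENNReal.ofReal e + ENNReal.ofReal e + ENNReal.ofReal e) := by
        rw [lintegral_const_mul' _ _ (by norm_num),
          lintegral_add_left ((hm _ _).fun_add (hm _ _)), lintegral_add_left (hm _ _)]
        gcongr
        exact hA τ (ne_of_gt hτ)
    _ = r := by
        rw [← ENNReal.ofReal_add he.le he.le, ← ENNReal.ofReal_add (by positivity) he.le,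
          show (3 : ENNReal) = ENNReal.ofReal 3 by norm_num, ← ENNReal.ofReal_mul (by norm_num),
          he_def, show 3 * ((r : ℝ) / 9 + r / 9 + r / 9) = r by ring, ENNReal.ofReal_coe_nnreal]
    _ ≤ ε₀ := hr.le

end

/-! ### Differentiation of integrals with compactly supported weights -/

/-- On a compact neighbourhood N of p₀ times the support of g, the jointly continuous derivative is
bounded by some C, so ‖g‖·C dominates. -/
lemma hasFDerivAt_integral_smul_of_hasCompactSupport {Y P V : Type*}
    [TopologicalSpace Y] [MeasurableSpace Y] [OpensMeasurableSpace Y] {μ : Measure Y}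
    [IsFiniteMeasureOnCompacts μ] [SecondCountableTopology Y]
    [NormedAddCommGroup P] [NormedSpace ℝ P] [LocallyCompactSpace P]
    [NormedAddCommGroup V] [NormedSpace ℝ V] [NormedSpace ℂ V] [SMulCommClass ℝ ℂ V]
    {F : P → Y → V} {F' : P → Y → P →L[ℝ] V} {g : Y → ℂ} {U : Set P} {p₀ : P}
    (hg : Continuous g) (hc : HasCompactSupport g) (hU : IsOpen U) (hp : p₀ ∈ U)
    (hF : ∀ p ∈ U, ∀ y, HasFDerivAt (fun p => F p y) (F' p y) p)
    (hFc : ∀ p ∈ U, Continuous (F p))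
    (hF'c : ContinuousOn (Function.uncurry F') (U ×ˢ univ)) :
    HasFDerivAt (fun p => ∫ y, g y • F p y ∂μ) (∫ y, g y • F' p₀ y ∂μ) p₀ := by
  obtain ⟨N, hN, hNU, hNc⟩ := local_compact_nhds (hU.mem_nhds hp)
  obtain ⟨C, hC⟩ := (hNc.prod hc).exists_bound_of_continuousOn
    (hF'c.mono (prod_mono hNU (subset_univ (tsupport g))))
  have hF'p : Continuous (F' p₀) :=
    hF'c.comp_continuous (f := fun y => (p₀, y)) (by fun_prop) fun y => ⟨hp, trivial⟩
  refine hasFDerivAt_integral_of_dominated_of_fderiv_le (bound := fun y => ‖g y‖ * C)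
    (F := fun p y => g y • F p y) (F' := fun p y => g y • F' p y) hN ?_ ?_ ?_
    ?_ ?_ ?_
  · filter_upwards [hU.mem_nhds hp] with p hp using
      ((hg.smul (hFc p hp)).integrable_of_hasCompactSupport hc.smul_right).aestronglyMeasurable
  · exact (hg.smul (hFc p₀ hp)).integrable_of_hasCompactSupport hc.smul_right
  · exact ((hg.smul hF'p).integrable_of_hasCompactSupport hc.smul_right).aestronglyMeasurable
  · refine Eventually.of_forall fun y p hpN => ?_
    rw [norm_smul]
    by_cases hy : y ∈ tsupport g
    · exact mul_le_mul_of_nonneg_left (hC (p, y) ⟨hpN, hy⟩) (norm_nonneg _)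
    · simp [image_eq_zero_of_notMem_tsupport hy]
  · exact (hg.norm.integrable_of_hasCompactSupport hc.norm).mul_const C
  · exact Eventually.of_forall fun y p hpN => (hF p (hNU hpN) y).const_smul (g y)

lemma integral_smul_clm_apply {Y P V : Type*}
    [TopologicalSpace Y] [MeasurableSpace Y] [OpensMeasurableSpace Y] {μ : Measure Y}
    [IsFiniteMeasureOnCompacts μ] [NormedAddCommGroup P] [NormedSpace ℝ P]
    [NormedAddCommGroup V] [NormedSpace ℝ V] [NormedSpace ℂ V] [SMulCommClass ℝ ℂ V]
    {F : Y → P →L[ℝ] V} {g : Y → ℂ}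
    (hg : Continuous g) (hc : HasCompactSupport g) (hF : Continuous F) (v : P) :
    (∫ y, g y • F y ∂μ) v = ∫ y, g y • F y v ∂μ :=
  ContinuousLinearMap.integral_apply
    ((hg.smul hF).integrable_of_hasCompactSupport hc.smul_right) v

section Convolution

variable {t₀ t₁ : ℝ} {h : ℝ → EuclideanSpace ℝ (Fin n) → ℂ} {g : EuclideanSpace ℝ (Fin n) → ℂ}

lemma continuous_integral_smul_comp_sub {X V : Type*} [TopologicalSpace X] [NormedAddCommGroup V]
    [NormedSpace ℝ V] [NormedSpace ℂ V] {s : Set X} {H : X × EuclideanSpace ℝ (Fin n) → V}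
    (hg : Continuous g) (hc : HasCompactSupport g) (hH : ContinuousOn H (s ×ˢ univ)) :
    ContinuousOn (fun q : X × EuclideanSpace ℝ (Fin n) => ∫ y, g y • H (q.1, q.2 - y))
      (s ×ˢ univ) := by
  refine continuousOn_integral_of_compact_support (k := tsupport g) hc ?_ ?_
  · refine ContinuousOn.smul (hg.comp continuous_snd).continuousOn ?_
    refine hH.comp (f := fun p : (X × EuclideanSpace ℝ (Fin n)) × EuclideanSpace ℝ (Fin n) =>
      (p.1.1, p.1.2 - p.2)) (by fun_prop) ?_
    exact fun p hp => ⟨hp.1.1, trivial⟩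
  · intro p y _ hy
    rw [image_eq_zero_of_notMem_tsupport hy, zero_smul]

lemma IsC21On.hasDerivAt_integral_smul (hh : IsC21On t₀ t₁ h) (hg : Continuous g)
    (hc : HasCompactSupport g) {t : ℝ} (ht : t ∈ Ioo t₀ t₁)
    {T : EuclideanSpace ℝ (Fin n) → EuclideanSpace ℝ (Fin n)} (hT : Continuous T) :
    HasDerivAt (fun s => ∫ y, g y • h s (T y))
      (∫ y, g y • deriv (fun s => h s (T y)) t) t := by
  have hcont : ContinuousOn (fun q : ℝ × EuclideanSpace ℝ (Fin n) =>
      deriv (fun s => h s (T q.2)) q.1) (Ioo t₀ t₁ ×ˢ univ) :=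
    hh.continuousOn_time.comp (f := fun q : ℝ × EuclideanSpace ℝ (Fin n) => (q.1, T q.2))
      (by fun_prop) fun q hq => ⟨hq.1, trivial⟩
  have h1 := hasFDerivAt_integral_smul_of_hasCompactSupport (μ := volume)
    (F := fun s y => h s (T y))
    (F' := fun s y => ContinuousLinearMap.toSpanSingleton ℝ (deriv (fun s => h s (T y)) s))
    hg hc isOpen_Ioo ht
    (fun s hs y => (hh.differentiable_time s hs (T y)).hasDerivAt.hasFDerivAt)
    (fun s hs => (hh.contDiff_space s hs).continuous.comp hT)
    ((ContinuousLinearMap.toSpanSingletonCLE (𝕜 := ℝ) (E := ℂ)).continuous.comp_continuousOn hcont)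
  refine h1.hasDerivAt.congr_deriv ?_
  have hd : Continuous (fun y => deriv (fun s => h s (T y)) t) :=
    hcont.comp_continuous (f := fun y => (t, y)) (by fun_prop) fun y => ⟨ht, trivial⟩
  rw [ContinuousLinearMap.integral_apply]
  · simp
  · refine Continuous.integrable_of_hasCompactSupport (hg.smul ?_) hc.smul_right
    exact (ContinuousLinearMap.toSpanSingletonCLE (𝕜 := ℝ) (E := ℂ)).continuous.comp hd

lemma IsC21On.hasFDerivAt_convolution (hh : IsC21On t₀ t₁ h) (hg : Continuous g)
    (hc : HasCompactSupport g) {t : ℝ} (ht : t ∈ Ioo t₀ t₁) (x : EuclideanSpace ℝ (Fin n)) :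
    HasFDerivAt (fun x => ∫ y, g y • h t (x - y)) (∫ y, g y • fderiv ℝ (h t) (x - y)) x := by
  have hct : Continuous (fderiv ℝ (h t)) :=
    (hh.contDiff_space t ht).continuous_fderiv (by norm_num)
  refine hasFDerivAt_integral_smul_of_hasCompactSupport (F := fun x y => h t (x - y))
    (F' := fun x y => fderiv ℝ (h t) (x - y)) hg hc isOpen_univ (mem_univ x) (fun p _ y => ?_)
    (fun p _ => (hh.contDiff_space t ht).continuous.comp (by fun_prop)) ?_
  · exact (hasFDerivAt_comp_sub y).2 (hh.differentiable ht (p - y)).hasFDerivAt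
  · exact (hct.comp (continuous_fst.sub continuous_snd)).continuousOn

lemma IsC21On.hasFDerivAt_fderiv_convolution (hh : IsC21On t₀ t₁ h) (hg : Continuous g)
    (hc : HasCompactSupport g) {t : ℝ} (ht : t ∈ Ioo t₀ t₁) (x : EuclideanSpace ℝ (Fin n)) :
    HasFDerivAt (fderiv ℝ (fun x => ∫ y, g y • h t (x - y)))
      (∫ y, g y • fderiv ℝ (fderiv ℝ (h t)) (x - y)) x := by
  have e : fderiv ℝ (fun x => ∫ y, g y • h t (x - y)) =
      fun x => ∫ y, g y • fderiv ℝ (h t) (x - y) :=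
    funext fun x => (hh.hasFDerivAt_convolution hg hc ht x).fderiv
  rw [e]
  have hct : Continuous (fderiv ℝ (h t)) :=
    (hh.contDiff_space t ht).continuous_fderiv (by norm_num)
  have hct2 : Continuous (fderiv ℝ (fderiv ℝ (h t))) :=
    ((hh.contDiff_space t ht).fderiv_right (m := 1) (by norm_num)).continuous_fderiv (by norm_num)
  refine hasFDerivAt_integral_smul_of_hasCompactSupport (F := fun x y => fderiv ℝ (h t) (x - y))
    (F' := fun x y => fderiv ℝ (fderiv ℝ (h t)) (x - y)) hg hc isOpen_univ (mem_univ x)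
    (fun p _ y => ?_) (fun p _ => hct.comp (by fun_prop)) ?_
  · exact (hasFDerivAt_comp_sub y).2
      (differentiable_fderiv_of_contDiff_two (hh.contDiff_space t ht) (p - y)).hasFDerivAt
  · exact (hct2.comp (continuous_fst.sub continuous_snd)).continuousOn

/-- All derivatives fall on h, because g is merely continuous. -/
lemma IsC21On.convolution (hh : IsC21On t₀ t₁ h) (hg : Continuous g) (hc : HasCompactSupport g) :
    IsC21On t₀ t₁ (fun t x => ∫ y, g y • h t (x - y)) where
  contDiff_space t ht := by
    have h1 := hh.hasFDerivAt_convolution hg hc ht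
    have h2 := hh.hasFDerivAt_fderiv_convolution hg hc ht
    rw [show (2 : WithTop ℕ∞) = 1 + 1 by norm_num, contDiff_succ_iff_fderiv]
    refine ⟨fun x => (h1 x).differentiableAt, by simp, ?_⟩
    rw [contDiff_one_iff_fderiv]
    refine ⟨fun x => (h2 x).differentiableAt, ?_⟩
    have h3 := continuous_integral_smul_comp_sub
      (V := EuclideanSpace ℝ (Fin n) →L[ℝ] EuclideanSpace ℝ (Fin n) →L[ℝ] ℂ)
      (H := fun q : ℝ × EuclideanSpace ℝ (Fin n) => fderiv ℝ (fderiv ℝ (h q.1)) q.2)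
      hg hc hh.continuousOn_space_space
    have h4 := h3.comp_continuous (f := fun x => (t, x)) (by fun_prop) fun x => ⟨ht, trivial⟩
    exact h4.congr fun x => (h2 x).fderiv.symm
  differentiable_time t ht x := (hh.hasDerivAt_integral_smul hg hc ht (continuous_sub_left x)).differentiableAt
  continuousOn := continuous_integral_smul_comp_sub hg hc hh.continuousOn
  continuousOn_time := (continuous_integral_smul_comp_sub hg hc hh.continuousOn_time).congr
    fun q hq => (hh.hasDerivAt_integral_smul hg hc hq.1 (continuous_sub_left q.2)).deriv
  continuousOn_space := (continuous_integral_smul_comp_sub hg hc hh.continuousOn_space).congr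
    fun q hq => (hh.hasFDerivAt_convolution hg hc hq.1 q.2).fderiv
  continuousOn_space_space :=
    (continuous_integral_smul_comp_sub
      (V := EuclideanSpace ℝ (Fin n) →L[ℝ] EuclideanSpace ℝ (Fin n) →L[ℝ] ℂ)
      (H := fun q : ℝ × EuclideanSpace ℝ (Fin n) => fderiv ℝ (fderiv ℝ (h q.1)) q.2)
      hg hc hh.continuousOn_space_space).congr
    fun q hq => (hh.hasFDerivAt_fderiv_convolution hg hc hq.1 q.2).fderiv

lemma IsC21On.laplacian_convolution (hh : IsC21On t₀ t₁ h) (hg : Continuous g)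
    (hc : HasCompactSupport g) {t : ℝ} (ht : t ∈ Ioo t₀ t₁) (x : EuclideanSpace ℝ (Fin n)) :
    Laplacian.laplacian (fun x => ∫ y, g y • h t (x - y)) x =
      ∫ y, g y • Laplacian.laplacian (h t) (x - y) := by
  have hct2 : Continuous (fderiv ℝ (fderiv ℝ (h t))) :=
    ((hh.contDiff_space t ht).fderiv_right (m := 1) (by norm_num)).continuous_fderiv (by norm_num)
  have hs : Continuous fun y => fderiv ℝ (fderiv ℝ (h t)) (x - y) := hct2.comp (by fun_prop)
  simp only [laplacian_eq_sum_fderiv_fderiv, (hh.hasFDerivAt_fderiv_convolution hg hc ht x).fderiv,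
    Finset.smul_sum]
  have hj : ∀ j : Fin n, Continuous fun y => fderiv ℝ (fderiv ℝ (h t)) (x - y)
      (EuclideanSpace.single j 1) := fun j => hs.clm_apply continuous_const
  rw [integral_finsetSum]
  · refine Finset.sum_congr rfl fun j _ => ?_
    have e1 := integral_smul_clm_apply (μ := volume) hg hc hs (EuclideanSpace.single j 1)
    have e2 := integral_smul_clm_apply (μ := volume) hg hc (hj j) (EuclideanSpace.single j 1)
    rw [← e2, ← e1]
  · intro j _
    exact (hg.smul ((hj j).clm_apply continuous_const)).integrable_of_hasCompactSupport
      hc.smul_right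

/-- If every translate of `h` solves `∂h/∂t = β Δh`, so does its convolution with a continuous
compactly supported function. -/
lemma IsC21On.deriv_convolution_eq {β : ℂ} (hh : IsC21On t₀ t₁ h) (hg : Continuous g)
    (hc : HasCompactSupport g)
    (heq : ∀ t ∈ Ioo t₀ t₁, ∀ x, deriv (fun s => h s x) t = β * Laplacian.laplacian (h t) x)
    {t : ℝ} (ht : t ∈ Ioo t₀ t₁) (x : EuclideanSpace ℝ (Fin n)) :
    deriv (fun s => ∫ y, g y • h s (x - y)) t =
      β * Laplacian.laplacian (fun x => ∫ y, g y • h t (x - y)) x := by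
  rw [(hh.hasDerivAt_integral_smul hg hc ht (continuous_sub_left x)).deriv, hh.laplacian_convolution hg hc ht,
    ← integral_const_mul]
  refine integral_congr_ae (Eventually.of_forall fun y => ?_)
  simp only [heq t ht, smul_eq_mul]
  ring

end Convolution

/-! ### The free Schrödinger flow and existence of a fundamental solution -/

lemma I_mul_hbar_div_mul_eq (hbar m t₀ t : ℝ) :
    (Complex.I * hbar / (2 * m) * (t - t₀) : ℂ) =
      Complex.I * ((hbar / (2 * m) * (t - t₀) : ℝ) : ℂ) := by
  push_cast
  ring

section Existence

variable {hbar m t₀ t₁ : ℝ} (hbar_pos : 0 < hbar) (hm : 0 < m)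
include hbar_pos hm

lemma I_mul_hbar_div_mul_mem_slitPlane {t : ℝ} (ht : t₀ < t) :
    (Complex.I * hbar / (2 * m) * (t - t₀) : ℂ) ∈ Complex.slitPlane := by
  rw [I_mul_hbar_div_mul_eq, Complex.mem_slitPlane_iff]
  right
  have : 0 < hbar / (2 * m) * (t - t₀) := mul_pos (by positivity) (sub_pos.2 ht)
  rw [Complex.mul_im, Complex.ofReal_re, Complex.ofReal_im]
  simpa only [Complex.I_re, Complex.I_im, zero_mul, zero_add, one_mul] using this.ne'

lemma affine_mem_slitPlane : ∀ t ∈ Ioo t₀ t₁,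
    (-(Complex.I * hbar / (2 * m) * t₀) + Complex.I * hbar / (2 * m) * t : ℂ) ∈
      Complex.slitPlane := fun t ht => by
  convert! I_mul_hbar_div_mul_mem_slitPlane hbar_pos hm ht.1 using 1
  ring

lemma isC21On_schrodingerKernel : IsC21On t₀ t₁ (fun t (x : EuclideanSpace ℝ (Fin n)) =>
    heatKernel (Complex.I * hbar / (2 * m) * (t - t₀)) x) := by
  refine (isC21On_heatKernel (affine_mem_slitPlane hbar_pos hm) 0).congr fun t _ x => ?_
  rw [sub_zero]
  congr 1
  ring

lemma deriv_schrodingerKernel {t : ℝ} (ht : t ∈ Ioo t₀ t₁) (x : EuclideanSpace ℝ (Fin n)) :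
    deriv (fun s : ℝ => heatKernel (Complex.I * hbar / (2 * m) * (s - t₀)) x) t =
      Complex.I * hbar / (2 * m) * Laplacian.laplacian
        (heatKernel (Complex.I * hbar / (2 * m) * (t - t₀))) x := by
  have h := deriv_heatKernel_eq (affine_mem_slitPlane (t₁ := t₁) hbar_pos hm) 0 x ht
  simp only [sub_zero] at h
  have e : ∀ s : ℝ, (Complex.I * hbar / (2 * m) * (s - t₀) : ℂ) =
      -(Complex.I * hbar / (2 * m) * t₀) + Complex.I * hbar / (2 * m) * s := fun s => by ring
  simp only [e]
  exact h

section Flow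

variable {g : EuclideanSpace ℝ (Fin n) → ℂ} (hg : Continuous g) (hc : HasCompactSupport g)
include hg hc

lemma isC21On_schrodingerFlow :
    IsC21On t₀ t₁ (fun t => heatFlow g (Complex.I * hbar / (2 * m) * (t - t₀))) := by
  refine ((isC21On_schrodingerKernel hbar_pos hm).convolution hg hc).congr fun t _ x => ?_
  simp only [heatFlow, smul_eq_mul, mul_comm (g _)]

lemma deriv_schrodingerFlow {t : ℝ} (ht : t ∈ Ioo t₀ t₁) (x : EuclideanSpace ℝ (Fin n)) :
    deriv (fun s : ℝ => heatFlow g (Complex.I * hbar / (2 * m) * (s - t₀)) x) t =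
      Complex.I * hbar / (2 * m) * Laplacian.laplacian
        (heatFlow g (Complex.I * hbar / (2 * m) * (t - t₀))) x := by
  have h := (isC21On_schrodingerKernel (t₀ := t₀) (t₁ := t₁) hbar_pos hm).deriv_convolution_eq
    hg hc (fun t ht x => deriv_schrodingerKernel hbar_pos hm ht x) ht x
  have e : ∀ (s : ℝ) x, heatFlow g (Complex.I * hbar / (2 * m) * (s - t₀)) x =
      ∫ y, g y • heatKernel (Complex.I * hbar / (2 * m) * (s - t₀)) (x - y) := fun s x => by
    simp only [heatFlow, smul_eq_mul, mul_comm (g _)]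
  simp only [e]
  rw [h, show heatFlow g (Complex.I * hbar / (2 * m) * (t - t₀)) = _ from funext (e t)]

end Flow

omit hbar_pos in
lemma isDriftSolution_of_wave {ψ u w : ℝ → EuclideanSpace ℝ (Fin n) → ℂ}
    {ψ₀ : EuclideanSpace ℝ (Fin n) → ℂ} (hψ : IsNonvanishingFreeWave hbar m t₀ t₁ ψ ψ₀)
    (hw : IsC21On t₀ t₁ w)
    (hweq : ∀ t ∈ Ioo t₀ t₁, ∀ x, deriv (fun s => w s x) t =
      Complex.I * hbar / (2 * m) * Laplacian.laplacian (w t) x)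
    (hu : ∀ t ∈ Ioo t₀ t₁, ∀ x, u t x = w t x / ψ t x) :
    IsDriftSolution hbar m t₀ t₁ ψ u := by
  have h0 : ∀ t ∈ Ioo t₀ t₁, ∀ x, ψ t x ≠ 0 := fun t ht => hψ.ne_zero t (Ioo_subset_Icc_self ht)
  have hu21 : IsC21On t₀ t₁ u :=
    (hw.mul (hψ.isC21On.inv h0)).congr fun t ht x => by rw [hu t ht x, div_eq_mul_inv]
  have hmul : ∀ t ∈ Ioo t₀ t₁, ∀ x, ψ t x * u t x = w t x := fun t ht x => by
    rw [hu t ht x, mul_div_cancel₀ _ (h0 t ht x)]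
  refine ⟨hu21, fun t ht x => (schrodinger_iff_drift hm hψ hu21 ht x).1 ?_⟩
  have e1 : (fun s => ψ s x * u s x) =ᶠ[𝓝 t] fun s => w s x := by
    filter_upwards [isOpen_Ioo.mem_nhds ht] with s hs using hmul s hs x
  rw [e1.deriv_eq, hweq t ht x, show (fun x => ψ t x * u t x) = w t from funext (hmul t ht)]

lemma tendsto_hbar_div_mul_sub :
    Tendsto (fun t : ℝ => hbar / (2 * m) * (t - t₀)) (𝓝[>] t₀) (𝓝[>] 0) := by
  refine tendsto_nhdsWithin_iff.2 ⟨?_, ?_⟩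
  · have hcont : Continuous fun t : ℝ => hbar / (2 * m) * (t - t₀) := by fun_prop
    exact (hcont.tendsto' t₀ 0 (by simp)).mono_left nhdsWithin_le_nhds
  · filter_upwards [self_mem_nhdsWithin] with t ht
    have ht : t₀ < t := ht
    exact mul_pos (by positivity) (sub_pos.2 ht)

omit hbar_pos hm in
lemma IsNonvanishingFreeWave.continuous_slice {ψ : ℝ → EuclideanSpace ℝ (Fin n) → ℂ}
    {ψ₀ : EuclideanSpace ℝ (Fin n) → ℂ} (hψ : IsNonvanishingFreeWave hbar m t₀ t₁ ψ ψ₀)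
    {t : ℝ} (ht : t ∈ Icc t₀ t₁) : Continuous (ψ t) :=
  hψ.continuousOn.comp_continuous (f := fun x => (t, x)) (by fun_prop) fun x => ⟨ht, trivial⟩

omit hbar_pos hm in
lemma IsNonvanishingFreeWave.continuous_initial {ψ : ℝ → EuclideanSpace ℝ (Fin n) → ℂ}
    {ψ₀ : EuclideanSpace ℝ (Fin n) → ℂ} (hψ : IsNonvanishingFreeWave hbar m t₀ t₁ ψ ψ₀)
    (ht : t₀ < t₁) : Continuous ψ₀ := by
  rw [← show ψ t₀ = ψ₀ from funext hψ.initial]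
  exact hψ.continuous_slice ⟨le_rfl, ht.le⟩

omit hbar_pos hm in
-- The flow converges to ψ₀f, whereas the Cauchy condition compares ψu with the moving datum ψ(t)f.
-- The gap lives on the compact support of f, where ψ is continuous up to t₀.
lemma tendsto_lintegral_wave_sub_sq {ψ : ℝ → EuclideanSpace ℝ (Fin n) → ℂ}
    {ψ₀ f : EuclideanSpace ℝ (Fin n) → ℂ} (hψ : IsNonvanishingFreeWave hbar m t₀ t₁ ψ ψ₀)
    (ht : t₀ < t₁) (hf : Continuous f) (hc : HasCompactSupport f) :
    Tendsto (fun t => ∫⁻ x, ‖ψ₀ x * f x - ψ t x * f x‖ₑ ^ 2) (𝓝[>] t₀) (𝓝 0) := by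
  have hψ₀ := hψ.continuous_initial ht
  have h1 : ContinuousOn (fun t => ∫ x, ‖ψ₀ x * f x - ψ t x * f x‖ ^ 2) (Icc t₀ t₁) := by
    refine continuousOn_integral_of_compact_support (k := tsupport f) hc ?_ ?_
    · refine ContinuousOn.pow (ContinuousOn.norm (ContinuousOn.sub ?_ ?_)) 2
      · exact ((hψ₀.mul hf).comp continuous_snd).continuousOn
      · exact hψ.continuousOn.mul (hf.comp continuous_snd).continuousOn
    · intro t x _ hx
      simp [image_eq_zero_of_notMem_tsupport hx]
  have h2 := (h1 t₀ ⟨le_rfl, ht.le⟩).tendsto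
  have h3 : 𝓝[>] t₀ ≤ 𝓝[Icc t₀ t₁] t₀ := by
    rw [← nhdsWithin_Ioo_eq_nhdsGT ht]
    exact nhdsWithin_mono _ Ioo_subset_Icc_self
  have h4 := ENNReal.tendsto_ofReal (h2.mono_left h3)
  simp only [hψ.initial, sub_self, norm_zero, ne_eq, OfNat.ofNat_ne_zero, not_false_eq_true,
    zero_pow, integral_zero, ENNReal.ofReal_zero] at h4
  refine h4.congr' ?_
  filter_upwards [Ioo_mem_nhdsGT ht] with t ht'
  have hct : Continuous (fun x => ‖ψ₀ x * f x - ψ t x * f x‖ ^ 2) :=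
    (((hψ₀.mul hf).sub ((hψ.continuous_slice (Ioo_subset_Icc_self ht')).mul hf)).norm).pow 2
  rw [ofReal_integral_eq_lintegral_ofReal]
  · refine lintegral_congr fun x => ?_
    rw [← ofReal_norm, ENNReal.ofReal_pow (norm_nonneg _)]
  · refine hct.integrable_of_hasCompactSupport (hc.mono fun x hx => ?_)
    contrapose! hx
    simp only [Function.mem_support, not_not] at hx
    simp [hx]
  · exact Eventually.of_forall fun x => by positivity

lemma isCauchySolution_schrodingerFlow {ψ u : ℝ → EuclideanSpace ℝ (Fin n) → ℂ}
    {ψ₀ f : EuclideanSpace ℝ (Fin n) → ℂ} (hψ : IsNonvanishingFreeWave hbar m t₀ t₁ ψ ψ₀)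
    (ht : t₀ < t₁) (hf : Continuous f) (hc : HasCompactSupport f)
    (hu : ∀ t ∈ Ioo t₀ t₁, ∀ x, u t x =
      heatFlow (fun y => ψ₀ y * f y) (Complex.I * hbar / (2 * m) * (t - t₀)) x / ψ t x) :
    IsCauchySolution hbar m t₀ t₁ ψ u f := by
  have hψ₀ := hψ.continuous_initial ht
  have hg : Continuous fun y => ψ₀ y * f y := hψ₀.mul hf
  have hgc : HasCompactSupport fun y => ψ₀ y * f y := hc.mul_left
  have h0 : ∀ t ∈ Ioo t₀ t₁, ∀ x, ψ t x ≠ 0 := fun t ht => hψ.ne_zero t (Ioo_subset_Icc_self ht)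
  have hmul : ∀ t ∈ Ioo t₀ t₁, ∀ x, ψ t x * u t x =
      heatFlow (fun y => ψ₀ y * f y) (Complex.I * hbar / (2 * m) * (t - t₀)) x := fun t ht x => by
    rw [hu t ht x, mul_div_cancel₀ _ (h0 t ht x)]
  refine ⟨isDriftSolution_of_wave hm hψ (isC21On_schrodingerFlow hbar_pos hm hg hgc)
    (fun t ht x => deriv_schrodingerFlow hbar_pos hm hg hgc ht x) hu, ?_, ?_⟩
  · obtain ⟨C, hC, h⟩ := exists_lintegral_heatFlow_I_le hg hgc
    calc ∫⁻ t in Ioo t₀ t₁, ∫⁻ x, ‖ψ t x * u t x‖ₑ ^ 2 ≤ ∫⁻ t in Ioo t₀ t₁, C := by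
          refine setLIntegral_mono measurable_const fun t ht => ?_
          simp only [hmul t ht, I_mul_hbar_div_mul_eq]
          exact h _ (mul_pos (by positivity) (sub_pos.2 ht.1)).ne'
      _ < ⊤ := by
          rw [setLIntegral_const, Real.volume_Ioo]
          exact ENNReal.mul_lt_top hC ENNReal.ofReal_lt_top
  -- The weighted quantity |u-f|²|ψ|² is |ψu - ψf|², and ψu - ψf splits as (flow - ψ₀f) + (ψ₀f -
  -- ψf). The factor 3 comes from the three-term inequality with a zero third term.
  · have h1 := (tendsto_lintegral_heatFlow_I_sub hg hgc).comp
      (tendsto_hbar_div_mul_sub (t₀ := t₀) hbar_pos hm)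
    have h2 := tendsto_lintegral_wave_sub_sq hψ ht hf hc
    have h3 := ENNReal.Tendsto.const_mul (a := 3) (h1.add h2) (Or.inr (by norm_num))
    rw [add_zero, mul_zero] at h3
    refine tendsto_of_tendsto_of_tendsto_of_le_of_le' tendsto_const_nhds h3
      (Eventually.of_forall fun t => bot_le) ?_
    filter_upwards [Ioo_mem_nhdsGT ht] with t ht'
    have hm1 : Measurable fun x => ‖heatFlow (fun y => ψ₀ y * f y)
        (Complex.I * ((hbar / (2 * m) * (t - t₀) : ℝ) : ℂ)) x - ψ₀ x * f x‖ₑ ^ 2 :=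
      ((continuous_heatFlow hg hgc _).sub hg).measurable.enorm.pow_const 2
    simp only [Function.comp_apply]
    rw [← lintegral_add_left hm1, ← lintegral_const_mul' _ _ (by norm_num)]
    refine lintegral_mono fun x => ?_
    have e := enorm_add_add_sq_le (heatFlow (fun y => ψ₀ y * f y)
        (Complex.I * ((hbar / (2 * m) * (t - t₀) : ℝ) : ℂ)) x - ψ₀ x * f x)
        (ψ₀ x * f x - ψ t x * f x) 0
    rw [← mul_pow, ← enorm_mul, sub_mul, mul_comm (u t x), hmul t ht' x, mul_comm (f x),
      I_mul_hbar_div_mul_eq]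
    simpa using e

lemma exists_isFundamentalSolution {ψ : ℝ → EuclideanSpace ℝ (Fin n) → ℂ}
    {ψ₀ : EuclideanSpace ℝ (Fin n) → ℂ} (hψ : IsNonvanishingFreeWave hbar m t₀ t₁ ψ ψ₀)
    (ht : t₀ < t₁) : ∃ p, IsFundamentalSolution hbar m t₀ t₁ ψ p := by
  have hψ₀ := hψ.continuous_initial ht
  -- The witness is the only possible one, ψ₀(y)K/ψ. It is continuous up to t₁ because ψ does not
  -- vanish on the closed interval.
  refine ⟨fun y t x => ψ₀ y * heatKernel (Complex.I * hbar / (2 * m) * (t - t₀)) (x - y) / ψ t x,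
    ?_, fun y => ?_, fun f hf hc => ?_⟩
  · refine ContinuousOn.div (ContinuousOn.mul ?_ ?_) ?_ ?_
    · exact (hψ₀.comp continuous_fst).continuousOn
    · refine continuousOn_heatKernel.comp (f := fun q : EuclideanSpace ℝ (Fin n) × ℝ ×
        EuclideanSpace ℝ (Fin n) =>
        ((Complex.I * hbar / (2 * m) * (q.2.1 - t₀) : ℂ), q.2.2 - q.1)) ?_ ?_
      · exact Continuous.continuousOn (by fun_prop)
      · exact fun q hq => ⟨I_mul_hbar_div_mul_mem_slitPlane hbar_pos hm hq.2.1.1, trivial⟩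
    · exact hψ.continuousOn.comp (by fun_prop) fun q hq => ⟨Ioc_subset_Icc_self hq.2.1, trivial⟩
    · exact fun q hq => hψ.ne_zero _ (Ioc_subset_Icc_self hq.2.1) _
  · have e : ∀ s : ℝ, (Complex.I * hbar / (2 * m) * (s - t₀) : ℂ) =
        -(Complex.I * hbar / (2 * m) * t₀) + Complex.I * hbar / (2 * m) * s := fun s => by ring
    refine isDriftSolution_of_wave hm hψ
      (w := fun t x => ψ₀ y * heatKernel (Complex.I * hbar / (2 * m) * (t - t₀)) (x - y))
      ?_ ?_ fun t ht x => rfl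
    · simp only [e]
      exact (isC21On_const (ψ₀ y)).mul (isC21On_heatKernel (affine_mem_slitPlane hbar_pos hm) y)
    · intro t ht x
      simp only [e]
      have h21 := isC21On_heatKernel (affine_mem_slitPlane (t₀ := t₀) (t₁ := t₁) hbar_pos hm) y
      have hl := laplacian_mul (f := fun _ => ψ₀ y) contDiff_const (h21.contDiff_space t ht) x
      simp only [laplacian_eq_sum_fderiv_fderiv (fun _ : EuclideanSpace ℝ (Fin n) => ψ₀ y)] at hl
      simp only [spaceDeriv, fderiv_fun_const, Pi.zero_apply, fderiv_zero,
        zero_apply, zero_mul, Finset.sum_const_zero, mul_zero,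
        add_zero] at hl
      rw [hl, deriv_const_mul _ (h21.differentiable_time t ht x),
        deriv_heatKernel_eq (affine_mem_slitPlane hbar_pos hm) y x ht]
      ring
  · refine isCauchySolution_schrodingerFlow hbar_pos hm hψ ht hf hc fun t _ x => ?_
    rw [heatFlow, ← integral_div]
    refine integral_congr_ae (Eventually.of_forall fun y => ?_)
    simp only
    ring

end Existence

/-! ### Green's identity and cutoff functions -/

lemma integral_laplacian_mul {w φ : EuclideanSpace ℝ (Fin n) → ℂ} (hw : ContDiff ℝ 2 w)
    (hφ : ContDiff ℝ 2 φ) (hc : HasCompactSupport φ) :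
    ∫ x, Laplacian.laplacian w x * φ x = ∫ x, w x * Laplacian.laplacian φ x := by
  have hsd : ∀ {f : EuclideanSpace ℝ (Fin n) → ℂ} (_ : ContDiff ℝ 2 f) (j : Fin n),
      ContDiff ℝ 1 (spaceDeriv f j) := fun hf j =>
    (hf.fderiv_right (m := 1) (by norm_num)).clm_apply contDiff_const
  have hsd2 : ∀ {f : EuclideanSpace ℝ (Fin n) → ℂ} (_ : ContDiff ℝ 2 f) (j : Fin n),
      Continuous (spaceDeriv (spaceDeriv f j) j) := fun hf j =>
    ((hsd hf j).continuous_fderiv (by norm_num)).clm_apply continuous_const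
  have hcd : ∀ {f : EuclideanSpace ℝ (Fin n) → ℂ} (_ : HasCompactSupport f) (j : Fin n),
      HasCompactSupport (spaceDeriv f j) := fun hf j => hf.fderiv_apply ℝ _
  have hwd : Differentiable ℝ w := hw.differentiable (by norm_num)
  have hφd : Differentiable ℝ φ := hφ.differentiable (by norm_num)
  have hj : ∀ j : Fin n, ∫ x, spaceDeriv (spaceDeriv w j) j x * φ x =
      ∫ x, w x * spaceDeriv (spaceDeriv φ j) j x := by
    intro j
    have e1 : ∫ x, spaceDeriv w j x * spaceDeriv φ j x =
        - ∫ x, spaceDeriv (spaceDeriv w j) j x * φ x := by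
      refine integral_mul_fderiv_eq_neg_fderiv_mul_of_integrable ?_ ?_ ?_
        (fun x _ => (hsd hw j).differentiable (by norm_num) x) (fun x _ => hφd x)
      · exact ((hsd2 hw j).mul hφ.continuous).integrable_of_hasCompactSupport hc.mul_left
      · exact ((hsd hw j).continuous.mul (hsd hφ j).continuous).integrable_of_hasCompactSupport
          (hcd hc j).mul_left
      · exact ((hsd hw j).continuous.mul hφ.continuous).integrable_of_hasCompactSupport hc.mul_left
    have e2 : ∫ x, w x * spaceDeriv (spaceDeriv φ j) j x =
        - ∫ x, spaceDeriv w j x * spaceDeriv φ j x := by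
      refine integral_mul_fderiv_eq_neg_fderiv_mul_of_integrable ?_ ?_ ?_
        (fun x _ => hwd x) (fun x _ => (hsd hφ j).differentiable (by norm_num) x)
      · exact ((hsd hw j).continuous.mul (hsd hφ j).continuous).integrable_of_hasCompactSupport
          (hcd hc j).mul_left
      · exact (hw.continuous.mul (hsd2 hφ j)).integrable_of_hasCompactSupport
          (hcd (hcd hc j) j).mul_left
      · exact (hw.continuous.mul (hsd hφ j).continuous).integrable_of_hasCompactSupport
          (hcd hc j).mul_left
    rw [e2, e1, neg_neg]
  simp only [laplacian_eq_sum_spaceDeriv hw, laplacian_eq_sum_spaceDeriv hφ, Finset.sum_mul,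
    Finset.mul_sum]
  rw [integral_finsetSum, integral_finsetSum]
  · exact Finset.sum_congr rfl fun j _ => hj j
  · exact fun j _ => (hw.continuous.mul (hsd2 hφ j)).integrable_of_hasCompactSupport
      (hcd (hcd hc j) j).mul_left
  · exact fun j _ => ((hsd2 hw j).mul hφ.continuous).integrable_of_hasCompactSupport hc.mul_left

lemma continuous_laplacian {w : EuclideanSpace ℝ (Fin n) → ℂ} (hw : ContDiff ℝ 2 w) :
    Continuous (Laplacian.laplacian w : EuclideanSpace ℝ (Fin n) → ℂ) := by
  have h : Continuous (fderiv ℝ (fderiv ℝ w)) :=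
    (hw.fderiv_right (m := 1) (by norm_num)).continuous_fderiv (by norm_num)
  have h2 : (Laplacian.laplacian w : EuclideanSpace ℝ (Fin n) → ℂ) = fun x => ∑ j,
      fderiv ℝ (fderiv ℝ w) x (EuclideanSpace.single j 1) (EuclideanSpace.single j 1) :=
    funext fun x => laplacian_eq_sum_fderiv_fderiv w x
  rw [h2]
  exact continuous_finsetSum _ fun j _ => (h.clm_apply continuous_const).clm_apply continuous_const

/-- Green's identity with a cutoff function. -/
lemma integral_cutoff_mul_laplacian {χ w v : EuclideanSpace ℝ (Fin n) → ℂ}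
    (hχ : ContDiff ℝ 2 χ) (hc : HasCompactSupport χ) (hw : ContDiff ℝ 2 w) (hv : ContDiff ℝ 2 v) :
    ∫ x, χ x * (Laplacian.laplacian w x * v x - w x * Laplacian.laplacian v x) =
      ∫ x, w x * (2 * ∑ j, spaceDeriv χ j x * spaceDeriv v j x
        + Laplacian.laplacian χ x * v x) := by
  have h1 := integral_laplacian_mul hw (hχ.mul hv) hc.mul_right
  have i1 : Integrable fun x => Laplacian.laplacian w x * (χ x * v x) :=
    ((continuous_laplacian hw).mul (hχ.continuous.mul hv.continuous)).integrable_of_hasCompactSupport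
      hc.mul_right.mul_left
  have i2 : Integrable fun x => w x * (χ x * Laplacian.laplacian v x) :=
    (hw.continuous.mul (hχ.continuous.mul (continuous_laplacian hv))).integrable_of_hasCompactSupport
      hc.mul_right.mul_left
  have i3 : Integrable fun x => w x * Laplacian.laplacian (fun x => χ x * v x) x := by
    refine (hw.continuous.mul (continuous_laplacian (hχ.mul hv))).integrable_of_hasCompactSupport ?_
    have hc2 : HasCompactSupport (fderiv ℝ (fderiv ℝ (fun x => χ x * v x))) :=
      (hc.mul_right.fderiv ℝ).fderiv ℝ
    refine HasCompactSupport.mul_left (hc2.mono fun x hx => ?_)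
    contrapose! hx
    simp only [Function.mem_support, not_not] at hx ⊢
    rw [laplacian_eq_sum_fderiv_fderiv, hx]
    simp
  calc ∫ x, χ x * (Laplacian.laplacian w x * v x - w x * Laplacian.laplacian v x)
      = (∫ x, Laplacian.laplacian w x * (χ x * v x)) -
          ∫ x, w x * (χ x * Laplacian.laplacian v x) := by
        rw [← integral_sub i1 i2]
        refine integral_congr_ae (Eventually.of_forall fun x => ?_)
        simp only
        ring
    _ = ∫ x, (w x * Laplacian.laplacian (fun x => χ x * v x) x -
          w x * (χ x * Laplacian.laplacian v x)) := by
        rw [h1, integral_sub i3 i2]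
    _ = _ := by
        refine integral_congr_ae (Eventually.of_forall fun x => ?_)
        simp only
        rw [laplacian_mul hχ hv]
        ring

lemma fderiv_smul_comp_smul {P V : Type*} [NormedAddCommGroup P] [NormedSpace ℝ P]
    [NormedAddCommGroup V] [NormedSpace ℝ V] {F : P → V} (hF : Differentiable ℝ F) (r : ℝ) (x : P) :
    fderiv ℝ (fun x => r • F (r • x)) x = r • r • fderiv ℝ F (r • x) := by
  rw [fderiv_fun_const_smul, fderiv_comp_smul]
  exact (hF.comp (differentiable_id.const_smul r)) x

/-- Rescale one bump: χ_k(x) = X(x/(k+1)). Each derivative gains a factor 1/(k+1); the Laplacian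
gains two, of which one is enough. -/
lemma exists_cutoff (n : ℕ) : ∃ (χ : ℕ → EuclideanSpace ℝ (Fin n) → ℂ) (c : ℝ), 0 ≤ c ∧
    (∀ k, ContDiff ℝ 2 (χ k)) ∧ (∀ k, HasCompactSupport (χ k)) ∧ (∀ k x, ‖χ k x‖ ≤ 1) ∧
    (∀ k x j, ‖spaceDeriv (χ k) j x‖ ≤ c / (k + 1)) ∧
    (∀ k x, ‖Laplacian.laplacian (χ k) x‖ ≤ c / (k + 1)) ∧
    ∀ x, Tendsto (fun k => χ k x) atTop (𝓝 1) := by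
  let φ : ContDiffBump (0 : EuclideanSpace ℝ (Fin n)) := ⟨1, 2, one_pos, one_lt_two⟩
  set X : EuclideanSpace ℝ (Fin n) → ℂ := fun x => Complex.ofRealCLM (φ x) with hX
  have hXd : ContDiff ℝ 2 X := Complex.ofRealCLM.contDiff.comp φ.contDiff
  have hXc : HasCompactSupport X := φ.hasCompactSupport.comp_left (map_zero _)
  have hX1 : ContDiff ℝ 1 (fderiv ℝ X) := hXd.fderiv_right (by norm_num)
  obtain ⟨C₁, hC₁⟩ := hX1.continuous.bounded_above_of_compact_support (hXc.fderiv ℝ)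
  obtain ⟨C₂, hC₂⟩ := (hX1.continuous_fderiv (by norm_num)).bounded_above_of_compact_support
    ((hXc.fderiv ℝ).fderiv ℝ)
  have hC₁0 : 0 ≤ C₁ := (norm_nonneg _).trans (hC₁ 0)
  have hC₂0 : 0 ≤ C₂ := (norm_nonneg _).trans (hC₂ 0)
  have hf1 : ∀ (r : ℝ) x, fderiv ℝ (fun x => X (r • x)) x = r • fderiv ℝ X (r • x) := fun r x =>
    fderiv_comp_smul r
  have hf2 : ∀ (r : ℝ) x, fderiv ℝ (fderiv ℝ (fun x => X (r • x))) x =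
      r • r • fderiv ℝ (fderiv ℝ X) (r • x) := fun r x => by
    have e : fderiv ℝ (fun x => X (r • x)) = fun x => r • fderiv ℝ X (r • x) := funext (hf1 r)
    rw [e]
    exact fderiv_smul_comp_smul (hX1.differentiable (by norm_num)) r x
  have hk0 : ∀ k : ℕ, (0 : ℝ) < ((k : ℝ) + 1)⁻¹ := fun k => by positivity
  have hk1 : ∀ k : ℕ, ((k : ℝ) + 1)⁻¹ ≤ 1 := fun k =>
    inv_le_one_of_one_le₀ (by linarith [k.cast_nonneg (α := ℝ)])
  have hs : ∀ j : Fin n, ‖(EuclideanSpace.single j 1 : EuclideanSpace ℝ (Fin n))‖ = 1 := by simp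
  -- C₁ bounds the gradient of X, and n·C₂ its Laplacian, a sum of n second derivatives.
  refine ⟨fun k x => X (((k : ℝ) + 1)⁻¹ • x), C₁ + n * C₂, by positivity, fun k => ?_, fun k => ?_,
    fun k x => ?_, fun k x j => ?_, fun k x => ?_, fun x => ?_⟩
  · exact hXd.comp (contDiff_id.const_smul _)
  · exact hXc.comp_smul (hk0 k).ne'
  · simp only [hX, Complex.ofRealCLM_apply, Complex.norm_real, Real.norm_of_nonneg φ.nonneg]
    exact φ.le_one
  · rw [spaceDeriv, hf1, smul_apply, norm_smul, Real.norm_of_nonneg (hk0 k).le,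
      div_eq_inv_mul]
    have h1 := (fderiv ℝ X (((k : ℝ) + 1)⁻¹ • x)).le_opNorm (EuclideanSpace.single j 1)
    rw [hs, mul_one] at h1
    refine mul_le_mul_of_nonneg_left ?_ (hk0 k).le
    have := hC₁ (((k : ℝ) + 1)⁻¹ • x)
    have : 0 ≤ n * C₂ := by positivity
    linarith
  · rw [laplacian_eq_sum_fderiv_fderiv, hf2]
    calc _ ≤ ∑ j : Fin n, ((k : ℝ) + 1)⁻¹ * C₂ := by
          refine norm_sum_le_of_le _ fun j _ => ?_
          simp only [smul_apply, norm_smul, Real.norm_of_nonneg (hk0 k).le]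
          refine mul_le_mul_of_nonneg_left ?_ (hk0 k).le
          have h1 := (fderiv ℝ (fderiv ℝ X) (((k : ℝ) + 1)⁻¹ • x)).le_opNorm₂
            (EuclideanSpace.single j 1) (EuclideanSpace.single j 1)
          rw [hs, mul_one, mul_one] at h1
          have h2 := hC₂ (((k : ℝ) + 1)⁻¹ • x)
          have h3 := norm_nonneg (fderiv ℝ (fderiv ℝ X) (((k : ℝ) + 1)⁻¹ • x)
            (EuclideanSpace.single j 1) (EuclideanSpace.single j 1))
          nlinarith [hk1 k, hk0 k]
      _ ≤ _ := by
          rw [Finset.sum_const, Finset.card_univ, Fintype.card_fin, nsmul_eq_mul, div_eq_inv_mul]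
          have : 0 ≤ ((k : ℝ) + 1)⁻¹ * C₁ := mul_nonneg (hk0 k).le hC₁0
          linarith
  · have h1 : Tendsto (fun k : ℕ => ((k : ℝ) + 1)⁻¹ • x) atTop (𝓝 0) := by
      have := (tendsto_one_div_add_atTop_nhds_zero_nat (𝕜 := ℝ)).smul_const x
      simpa using this
    have h2 := (hXd.continuous.tendsto 0).comp h1
    have h3 : X 0 = 1 := by
      have : φ (0 : EuclideanSpace ℝ (Fin n)) = 1 :=
        φ.one_of_mem_closedBall (Metric.mem_closedBall_self φ.rIn_pos.le)
      simp [hX, this]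
    rwa [h3] at h2

/-! ### Conservation of the pairing with solutions of the adjoint equation -/

lemma norm_mul_le_sq_add_sq (a : ℂ) (h : ℝ) (b : ℂ) (hb : ‖b‖ ≤ h) :
    ‖a * b‖ₑ ≤ ‖a‖ₑ ^ 2 + ENNReal.ofReal (h ^ 2) := by
  simp only [← ofReal_norm, ← ENNReal.ofReal_pow (norm_nonneg _)]
  rw [← ENNReal.ofReal_add (by positivity) (by positivity)]
  refine ENNReal.ofReal_le_ofReal ?_
  rw [norm_mul]
  have h1 : ‖a‖ * ‖b‖ ≤ ‖a‖ * h := mul_le_mul_of_nonneg_left hb (norm_nonneg _)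
  nlinarith [sq_nonneg (‖a‖ - h), sq_nonneg ‖a‖, sq_nonneg h]

lemma integrable_mul_of_lintegral_sq {w v : EuclideanSpace ℝ (Fin n) → ℂ}
    {h : EuclideanSpace ℝ (Fin n) → ℝ} (hw : Continuous w) (hv : Continuous v)
    (hh : Integrable fun x => h x ^ 2) (hvh : ∀ x, ‖v x‖ ≤ h x) (hw2 : ∫⁻ x, ‖w x‖ₑ ^ 2 < ⊤) :
    Integrable fun x => w x * v x := by
  refine ⟨(hw.mul hv).aestronglyMeasurable, ?_⟩
  have hh2 : ∫⁻ x, ENNReal.ofReal (h x ^ 2) < ⊤ := hh.lintegral_lt_top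
  calc ∫⁻ x, ‖w x * v x‖ₑ ≤ ∫⁻ x, (‖w x‖ₑ ^ 2 + ENNReal.ofReal (h x ^ 2)) :=
        lintegral_mono fun x => norm_mul_le_sq_add_sq _ _ _ (hvh x)
    _ = (∫⁻ x, ‖w x‖ₑ ^ 2) + ∫⁻ x, ENNReal.ofReal (h x ^ 2) :=
        lintegral_add_left (hw.measurable.enorm.pow_const 2) _
    _ < ⊤ := ENNReal.add_lt_top.2 ⟨hw2, hh2⟩

section Pairing

variable {t₀ t₁ : ℝ} {β : ℂ} {w v : ℝ → EuclideanSpace ℝ (Fin n) → ℂ}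
  (hw : IsC21On t₀ t₁ w) (hv : IsC21On t₀ t₁ v)
  (hweq : ∀ t ∈ Ioo t₀ t₁, ∀ x, deriv (fun s => w s x) t = β * Laplacian.laplacian (w t) x)
  (hveq : ∀ t ∈ Ioo t₀ t₁, ∀ x, deriv (fun s => v s x) t = -β * Laplacian.laplacian (v t) x)
include hw hv hweq hveq

/-- The pairing is bilinear, without conjugation, so the adjoint equation carries -β. By Green's
identity only terms containing derivatives of χ remain. -/
lemma hasDerivAt_integral_cutoff_mul {χ : EuclideanSpace ℝ (Fin n) → ℂ} (hχ : ContDiff ℝ 2 χ)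
    (hc : HasCompactSupport χ) {t : ℝ} (ht : t ∈ Ioo t₀ t₁) :
    HasDerivAt (fun s => ∫ x, χ x * (w s x * v s x))
      (β * ∫ x, w t x * (2 * ∑ j, spaceDeriv χ j x * spaceDeriv (v t) j x
        + Laplacian.laplacian χ x * v t x)) t := by
  refine ((hw.mul hv).hasDerivAt_integral_smul hχ.continuous hc ht continuous_id).congr_deriv ?_
  rw [← integral_cutoff_mul_laplacian hχ hc (hw.contDiff_space t ht) (hv.contDiff_space t ht),
    ← integral_const_mul]
  refine integral_congr_ae (Eventually.of_forall fun x => ?_)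
  simp only [id, smul_eq_mul]
  rw [deriv_fun_mul (hw.differentiable_time t ht x) (hv.differentiable_time t ht x), hweq t ht,
    hveq t ht]
  ring

variable {h : EuclideanSpace ℝ (Fin n) → ℝ} (hvh : ∀ t ∈ Ioo t₀ t₁, ∀ x, ‖v t x‖ ≤ h x)
  (hvh' : ∀ t ∈ Ioo t₀ t₁, ∀ j x, ‖spaceDeriv (v t) j x‖ ≤ h x)
include hvh hvh'

/-- Integrate the derivative of the cut-off pairing over time. The cutoff terms are at most
d(2n+1)h: twice n gradient products and one Laplacian term. Then |w|h ≤ |w|² + h² leaves only the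
space-time integral of |w|², with no bound at individual times. The prefactor d is of order 1/k for
the k-th cutoff. -/
lemma enorm_integral_cutoff_mul_sub_le {χ : EuclideanSpace ℝ (Fin n) → ℂ} (hχ : ContDiff ℝ 2 χ)
    (hc : HasCompactSupport χ) {d : ℝ} (hd : ∀ x j, ‖spaceDeriv χ j x‖ ≤ d)
    (hd' : ∀ x, ‖Laplacian.laplacian χ x‖ ≤ d) (hd0 : 0 ≤ d)
    {s₁ s₂ : ℝ} (hs₁ : s₁ ∈ Ioo t₀ t₁) (hs₂ : s₂ ∈ Ioo t₀ t₁) (hs : s₁ ≤ s₂) :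
    ‖(∫ x, χ x * (w s₂ x * v s₂ x)) - ∫ x, χ x * (w s₁ x * v s₁ x)‖ₑ ≤
      ‖β‖ₑ * (ENNReal.ofReal (d * (2 * n + 1)) * ((∫⁻ t in Ioo t₀ t₁, ∫⁻ x, ‖w t x‖ₑ ^ 2) +
        ENNReal.ofReal (t₁ - t₀) * ∫⁻ x, ENNReal.ofReal (h x ^ 2))) := by
  set R : ℝ → EuclideanSpace ℝ (Fin n) → ℂ := fun t x => 2 * ∑ j, spaceDeriv χ j x *
    spaceDeriv (v t) j x + Laplacian.laplacian χ x * v t x with hR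
  have hsub : Icc s₁ s₂ ⊆ Ioo t₀ t₁ := fun s hs => ⟨hs₁.1.trans_le hs.1, hs.2.trans_lt hs₂.2⟩
  have hRc : ContinuousOn (fun t => β * ∫ x, w t x * R t x) (Ioo t₀ t₁) := by
    refine continuousOn_const.mul ?_
    refine continuousOn_integral_of_compact_support (k := tsupport χ) hc ?_ ?_
    · refine hw.continuousOn.mul ((continuousOn_const.mul
        (continuousOn_finsetSum _ fun j _ => ContinuousOn.mul ?_ (hv.continuousOn_spaceDeriv j))).add
        (ContinuousOn.mul ?_ hv.continuousOn))
      · exact (((hχ.continuous_fderiv (by norm_num)).clm_apply continuous_const).comp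
          continuous_snd).continuousOn
      · exact ((continuous_laplacian hχ).comp continuous_snd).continuousOn
    · intro t x _ hx
      have h1 : fderiv ℝ χ x = 0 := image_eq_zero_of_notMem_tsupport fun hx' =>
        hx (tsupport_fderiv_subset ℝ hx')
      have h2 : fderiv ℝ (fderiv ℝ χ) x = 0 := image_eq_zero_of_notMem_tsupport fun hx' =>
        hx (tsupport_fderiv_subset ℝ (tsupport_fderiv_subset ℝ hx'))
      simp [hR, spaceDeriv, laplacian_eq_sum_fderiv_fderiv, h1, h2]
  have hftc := intervalIntegral.integral_eq_sub_of_hasDerivAt (a := s₁) (b := s₂)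
    (f := fun s => ∫ x, χ x * (w s x * v s x)) (f' := fun t => β * ∫ x, w t x * R t x)
    (fun t ht => hasDerivAt_integral_cutoff_mul hw hv hweq hveq hχ hc
      (hsub (by rwa [uIcc_of_le hs] at ht)))
    (ContinuousOn.intervalIntegrable (hRc.mono (by rwa [uIcc_of_le hs])))
  have hRb : ∀ t ∈ Ioo t₀ t₁, ∀ x, ‖R t x‖ ≤ d * (2 * n + 1) * h x := by
    intro t ht x
    have h1 : ‖∑ j, spaceDeriv χ j x * spaceDeriv (v t) j x‖ ≤ ∑ _j : Fin n, d * h x :=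
      norm_sum_le_of_le _ fun j _ => by
        rw [norm_mul]
        exact mul_le_mul (hd x j) (hvh' t ht j x) (norm_nonneg _) hd0
    rw [Finset.sum_const, Finset.card_univ, Fintype.card_fin, nsmul_eq_mul] at h1
    have h2 : ‖Laplacian.laplacian χ x * v t x‖ ≤ d * h x := by
      rw [norm_mul]
      exact mul_le_mul (hd' x) (hvh t ht x) (norm_nonneg _) hd0
    calc ‖R t x‖ ≤ ‖(2 : ℂ) * ∑ j, spaceDeriv χ j x * spaceDeriv (v t) j x‖ +
          ‖Laplacian.laplacian χ x * v t x‖ := norm_add_le _ _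
      _ ≤ 2 * (n * (d * h x)) + d * h x := by
          rw [norm_mul, Complex.norm_two]
          gcongr
      _ = _ := by ring
  have hpt : ∀ t ∈ Ioo t₀ t₁, ∀ x, ‖w t x * R t x‖ₑ ≤
      ENNReal.ofReal (d * (2 * n + 1)) * (‖w t x‖ₑ ^ 2 + ENNReal.ofReal (h x ^ 2)) := by
    intro t ht x
    have hhx : 0 ≤ h x := (norm_nonneg _).trans (hvh t ht x)
    have h1 := norm_mul_le_sq_add_sq (w t x) (h x) (h x : ℂ) (by simp [abs_of_nonneg hhx])
    refine le_trans ?_ (mul_le_mul_right h1 _)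
    rw [← ofReal_norm, ← ofReal_norm, ← ENNReal.ofReal_mul (by positivity)]
    refine ENNReal.ofReal_le_ofReal ?_
    rw [norm_mul, norm_mul, Complex.norm_real, Real.norm_of_nonneg hhx]
    have := mul_le_mul_of_nonneg_left (hRb t ht x) (norm_nonneg (w t x))
    linarith
  rw [← hftc, intervalIntegral.integral_of_le hs]
  have hmw : ∀ t ∈ Ioo t₀ t₁, Measurable fun x => ‖w t x‖ₑ ^ 2 := fun t ht =>
    (hw.contDiff_space t ht).continuous.measurable.enorm.pow_const 2
  calc ‖∫ t in Ioc s₁ s₂, β * ∫ x, w t x * R t x‖ₑ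
      ≤ ∫⁻ t in Ioc s₁ s₂, ‖β * ∫ x, w t x * R t x‖ₑ := enorm_integral_le_lintegral_enorm _
    _ ≤ ∫⁻ t in Ioo t₀ t₁, ‖β * ∫ x, w t x * R t x‖ₑ :=
        lintegral_mono_set (Ioc_subset_Icc_self.trans hsub)
    _ ≤ ∫⁻ t in Ioo t₀ t₁, ‖β‖ₑ * (ENNReal.ofReal (d * (2 * n + 1)) *
          ((∫⁻ x, ‖w t x‖ₑ ^ 2) + ∫⁻ x, ENNReal.ofReal (h x ^ 2))) := by
        refine setLIntegral_mono' measurableSet_Ioo fun t ht => ?_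
        rw [enorm_mul]
        gcongr
        refine (enorm_integral_le_lintegral_enorm _).trans ?_
        rw [← lintegral_add_left (hmw t ht), ← lintegral_const_mul' _ _ ENNReal.ofReal_ne_top]
        exact lintegral_mono fun x => hpt t ht x
    _ = _ := by
        rw [lintegral_const_mul' _ _ enorm_ne_top, lintegral_const_mul' _ _ ENNReal.ofReal_ne_top,
          lintegral_add_right _ measurable_const, setLIntegral_const, Real.volume_Ioo, mul_comm (∫⁻ x, _)]

/-- The pairing of a square integrable solution of `∂w/∂t = β Δw` with a rapidly decreasing solution
of the adjoint equation is conserved. -/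
lemma integral_mul_eq_of_square_integrable (hh : Integrable fun x => h x ^ 2)
    (hw2 : ∫⁻ t in Ioo t₀ t₁, ∫⁻ x, ‖w t x‖ₑ ^ 2 < ⊤) {s₁ s₂ : ℝ} (hs₁ : s₁ ∈ Ioo t₀ t₁)
    (hs₂ : s₂ ∈ Ioo t₀ t₁) (hs : s₁ ≤ s₂) (h₁ : ∫⁻ x, ‖w s₁ x‖ₑ ^ 2 < ⊤)
    (h₂ : ∫⁻ x, ‖w s₂ x‖ₑ ^ 2 < ⊤) : ∫ x, w s₂ x * v s₂ x = ∫ x, w s₁ x * v s₁ x := by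
  obtain ⟨χ, c, hc0, hχ, hχc, hχ1, hχd, hχl, hlim⟩ := exists_cutoff n
  -- Removing the cutoff needs w·v integrable on the slice. The space-time bound provides this for
  -- almost every time only, hence the separate hypotheses `h₁` and `h₂`.
  have hint : ∀ s ∈ Ioo t₀ t₁, ∫⁻ x, ‖w s x‖ₑ ^ 2 < ⊤ → Integrable fun x => w s x * v s x :=
    fun s hs h2 => integrable_mul_of_lintegral_sq (hw.contDiff_space s hs).continuous
      (hv.contDiff_space s hs).continuous hh (hvh s hs) h2
  have hconv : ∀ s ∈ Ioo t₀ t₁, ∫⁻ x, ‖w s x‖ₑ ^ 2 < ⊤ →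
      Tendsto (fun k => ∫ x, χ k x * (w s x * v s x)) atTop (𝓝 (∫ x, w s x * v s x)) := by
    intro s hs h2
    refine tendsto_integral_of_dominated_convergence (fun x => ‖w s x * v s x‖) (fun k => ?_)
      (hint s hs h2).norm (fun k => Eventually.of_forall fun x => ?_)
      (Eventually.of_forall fun x => ?_)
    · exact ((hχ k).continuous.mul ((hw.contDiff_space s hs).continuous.mul
        (hv.contDiff_space s hs).continuous)).aestronglyMeasurable
    · rw [norm_mul]
      exact mul_le_of_le_one_left (norm_nonneg _) (hχ1 k x)
    · simpa using (hlim x).mul_const (w s x * v s x)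
  have h1 := ((hconv s₂ hs₂ h₂).sub (hconv s₁ hs₁ h₁)).enorm
  set A := (∫⁻ t in Ioo t₀ t₁, ∫⁻ x, ‖w t x‖ₑ ^ 2) +
        ENNReal.ofReal (t₁ - t₀) * ∫⁻ x, ENNReal.ofReal (h x ^ 2)
  have hA : A ≠ ⊤ := (ENNReal.add_lt_top.2 ⟨hw2, ENNReal.mul_lt_top ENNReal.ofReal_lt_top
    hh.lintegral_lt_top⟩).ne
  have h2 : Tendsto (fun k : ℕ => ‖β‖ₑ * (ENNReal.ofReal (c / (k + 1) * (2 * n + 1)) * A)) atTop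
      (𝓝 0) := by
    have h3 : Tendsto (fun k : ℕ => c / ((k : ℝ) + 1) * (2 * n + 1)) atTop (𝓝 0) := by
      have := ((tendsto_one_div_add_atTop_nhds_zero_nat (𝕜 := ℝ)).const_mul c).mul_const
        (2 * (n : ℝ) + 1)
      simpa [div_eq_mul_inv] using this
    have h4 := ENNReal.Tendsto.const_mul (a := ‖β‖ₑ) (ENNReal.Tendsto.mul_const
      (ENNReal.tendsto_ofReal h3) (Or.inr hA)) (Or.inr enorm_ne_top)
    simpa using h4
  have h5 := le_of_tendsto_of_tendsto' h1 h2 fun k => enorm_integral_cutoff_mul_sub_le hw hv hweq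
    hveq hvh hvh' (hχ k) (hχc k) (hχd k) (hχl k) (by positivity) hs₁ hs₂ hs
  exact sub_eq_zero.1 (enorm_eq_zero.1 (le_antisymm h5 bot_le))

end Pairing

/-! ### Gaussian test functions -/

lemma integrable_exp_neg_mul_sq_norm {c : ℝ} (hc : 0 < c) (b : EuclideanSpace ℝ (Fin n)) :
    Integrable fun x => Real.exp (-c * ‖x - b‖ ^ 2) := by
  have h := (GaussianFourier.integrable_cexp_neg_mul_sq_norm_add (b := (c : ℂ))
    (V := EuclideanSpace ℝ (Fin n)) (by simpa using hc) 0 0).norm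
  have h2 : Integrable fun x : EuclideanSpace ℝ (Fin n) => Real.exp (-c * ‖x‖ ^ 2) := by
    refine h.congr (Eventually.of_forall fun x => ?_)
    simp only [Complex.norm_exp]
    congr 1
    rw [zero_mul, add_zero, show (-(c : ℂ) * (‖x‖ : ℂ) ^ 2) = ((-c * ‖x‖ ^ 2 : ℝ) : ℂ) by
      push_cast; rfl, Complex.ofReal_re]
  exact h2.comp_sub_right b

/-- Uniform Gaussian bounds on the heat kernel and its first derivatives. -/
lemma exists_heatKernel_gaussian_bound (n : ℕ) {ε Z : ℝ} (hε : 0 < ε) (hZ : 0 < Z) :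
    ∃ B c : ℝ, 0 < c ∧ ∀ (z : ℂ), z.re = ε → ‖z‖ ≤ Z → ∀ x : EuclideanSpace ℝ (Fin n),
      ‖heatKernel z x‖ ≤ B * Real.exp (-c * ‖x‖ ^ 2) ∧
      ∀ j, ‖spaceDeriv (heatKernel z) j x‖ ≤ B * Real.exp (-c * ‖x‖ ^ 2) := by
  set A : ℝ := (4 * Real.pi * ε) ^ (-(n : ℝ) / 2) with hA
  have hπ := Real.pi_pos
  have hA0 : 0 ≤ A := by positivity
  -- The exponent is Re(1/z)/4 = ε/(4|z|²) ≥ ε/(4Z²) = 2c. Half of this decay is kept; the other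
  -- half absorbs the factor ‖x‖ in the first derivatives.
  set c : ℝ := ε / (8 * Z ^ 2) with hc
  have hc0 : 0 < c := by positivity
  -- The product ‖x‖ exp(-c‖x‖²) is at most 1 + 1/c, and the derivative of the kernel carries
  -- 1/(2|z|) ≤ 1/(2ε).
  set M : ℝ := (1 + c⁻¹) / (2 * ε) with hM
  have hM0 : 0 ≤ M := by positivity
  refine ⟨A * (1 + M), c, hc0, fun z hz hzZ x => ?_⟩
  have hz0 : z ≠ 0 := ne_zero_of_re_pos (hz ▸ hε)
  have hzε : ε ≤ ‖z‖ := hz ▸ Complex.re_le_norm z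
  have h1 : ‖(4 * Real.pi * z : ℂ) ^ (-(n : ℂ) / 2)‖ ≤ A := by
    have e5 : (-(n : ℂ) / 2) = ((-(n : ℝ) / 2 : ℝ) : ℂ) := by push_cast; ring
    rw [e5, Complex.norm_cpow_real, norm_mul, norm_mul, Complex.norm_real, Complex.norm_ofNat,
      Real.norm_of_nonneg hπ.le]
    refine Real.rpow_le_rpow_of_nonpos (by positivity) (by gcongr) ?_
    have : (0 : ℝ) ≤ n := n.cast_nonneg
    linarith
  have h2 : 2 * c ≤ (z⁻¹).re / 4 := by
    rw [Complex.inv_re, hz, Complex.normSq_eq_norm_sq, hc]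
    have : ε / Z ^ 2 ≤ ε / ‖z‖ ^ 2 := by
      have := norm_pos_iff.2 hz0
      gcongr
    calc 2 * (ε / (8 * Z ^ 2)) = ε / Z ^ 2 / 4 := by ring
      _ ≤ _ := by gcongr
  have h3 : ‖heatKernel z x‖ ≤ A * (Real.exp (-c * ‖x‖ ^ 2) * Real.exp (-c * ‖x‖ ^ 2)) := by
    rw [norm_heatKernel, ← Real.exp_add]
    refine mul_le_mul h1 (Real.exp_le_exp.2 ?_) (Real.exp_pos _).le hA0
    nlinarith [sq_nonneg ‖x‖]
  have hexp : Real.exp (-c * ‖x‖ ^ 2) ≤ 1 := Real.exp_le_one_iff.2 (by nlinarith [sq_nonneg ‖x‖])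
  have hpos := Real.exp_pos (-c * ‖x‖ ^ 2)
  have h4 : ‖x‖ * Real.exp (-c * ‖x‖ ^ 2) ≤ 1 + c⁻¹ := by
    rw [neg_mul, Real.exp_neg, ← div_eq_mul_inv, div_le_iff₀ (Real.exp_pos _)]
    have h5 := Real.add_one_le_exp (c * ‖x‖ ^ 2)
    calc ‖x‖ ≤ 1 + ‖x‖ ^ 2 := by nlinarith [sq_nonneg (‖x‖ - 1), norm_nonneg x]
      _ ≤ (1 + c⁻¹) * (c * ‖x‖ ^ 2 + 1) := by
        have : c⁻¹ * c = 1 := inv_mul_cancel₀ hc0.ne'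
        have h6 : (1 + c⁻¹) * (c * ‖x‖ ^ 2 + 1) =
          c * ‖x‖ ^ 2 + 1 + (c⁻¹ * c) * ‖x‖ ^ 2 + c⁻¹ := by ring
        rw [h6, this]
        have : 0 ≤ c * ‖x‖ ^ 2 := by positivity
        have : 0 ≤ c⁻¹ := by positivity
        linarith
      _ ≤ _ := by gcongr
  refine ⟨h3.trans ?_, fun j => ?_⟩
  · rw [mul_assoc]
    refine mul_le_mul_of_nonneg_left ?_ hA0
    nlinarith
  · rw [spaceDeriv_heatKernel, norm_mul, norm_div, norm_neg, Complex.norm_real, norm_mul,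
      Complex.norm_two]
    have h7 : ‖x j‖ / (2 * ‖z‖) ≤ ‖x‖ / (2 * ε) := by
      gcongr
      exact PiLp.norm_apply_le x j
    calc ‖x j‖ / (2 * ‖z‖) * ‖heatKernel z x‖
        ≤ ‖x‖ / (2 * ε) * (A * (Real.exp (-c * ‖x‖ ^ 2) * Real.exp (-c * ‖x‖ ^ 2))) := by
          gcongr
      _ = A * (‖x‖ * Real.exp (-c * ‖x‖ ^ 2) / (2 * ε)) * Real.exp (-c * ‖x‖ ^ 2) := by ring
      _ ≤ A * M * Real.exp (-c * ‖x‖ ^ 2) := by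
          rw [hM]
          gcongr
      _ ≤ A * (1 + M) * Real.exp (-c * ‖x‖ ^ 2) := by
          gcongr
          linarith

/-- Since 1/(4ε) = 1 + 1/(4ε') for ε' = ε/(1-4ε), a fixed factor exp(-|x|²) can be split off.
Multiplying a square integrable function by it makes the function integrable, so the L¹ approximate
identity applies. -/
lemma heatKernel_eq_mul_exp {ε : ℝ} (hε : 0 < ε) (hε' : 4 * ε < 1)
    (x : EuclideanSpace ℝ (Fin n)) :
    heatKernel (ε : ℂ) x = (1 - 4 * ε : ℂ) ^ (-(n : ℂ) / 2) *
      (heatKernel ((ε / (1 - 4 * ε) : ℝ) : ℂ) x * (Real.exp (-1 * ‖x‖ ^ 2) : ℂ)) := by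
  have h0 : 0 < 1 - 4 * ε := by linarith
  have hπ := Real.pi_pos
  have h0' : (1 - 4 * ε : ℂ) ≠ 0 := by exact_mod_cast h0.ne'
  have hε0 : (ε : ℂ) ≠ 0 := by exact_mod_cast hε.ne'
  have e1 : (4 * Real.pi * ε : ℂ) =
      ((1 - 4 * ε : ℝ) : ℂ) * ((4 * Real.pi * (ε / (1 - 4 * ε)) : ℝ) : ℂ) := by
    push_cast
    field_simp
  rw [heatKernel, heatKernel, e1, Complex.mul_cpow_ofReal_nonneg h0.le (by positivity),
    Complex.ofReal_exp, mul_assoc (((4 * Real.pi * ((ε / (1 - 4 * ε) : ℝ) : ℂ) : ℂ)) ^ _),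
    ← Complex.exp_add, mul_assoc]
  push_cast
  congr 3
  field_simp
  ring

/-- The heat kernel is an approximate identity on continuous square integrable functions. -/
lemma tendsto_integral_heatKernel_mul_of_sq {w : EuclideanSpace ℝ (Fin n) → ℂ} (hw : Continuous w)
    (hw2 : ∫⁻ x, ‖w x‖ₑ ^ 2 < ⊤) (b : EuclideanSpace ℝ (Fin n)) :
    Tendsto (fun ε : ℝ => ∫ x, w x * heatKernel (ε : ℂ) (x - b)) (𝓝[>] 0) (𝓝 (w b)) := by
  set f : EuclideanSpace ℝ (Fin n) → ℂ := fun x => w x * (Real.exp (-1 * ‖x - b‖ ^ 2) : ℂ) with hf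
  have hgc : Continuous fun x : EuclideanSpace ℝ (Fin n) =>
      (Real.exp (-1 * ‖x - b‖ ^ 2) : ℂ) := by fun_prop
  have hfi : Integrable f := by
    refine integrable_mul_of_lintegral_sq (h := fun x => Real.exp (-1 * ‖x - b‖ ^ 2)) hw hgc ?_
      (fun x => ?_) hw2
    · refine (integrable_exp_neg_mul_sq_norm two_pos b).congr (Eventually.of_forall fun x => ?_)
      simp only [← Real.exp_nat_mul]
      congr 1
      push_cast
      ring
    · rw [Complex.norm_real, Real.norm_of_nonneg (Real.exp_pos _).le]
  have hfb : f b = w b := by simp [hf]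
  have h1 := tendsto_integral_heatKernel_mul hfi (b := b) (hw.mul hgc).continuousAt
  have h2 : Tendsto (fun ε : ℝ => ε / (1 - 4 * ε)) (𝓝[>] 0) (𝓝[>] 0) := by
    refine tendsto_nhdsWithin_iff.2 ⟨?_, ?_⟩
    · have : ContinuousAt (fun ε : ℝ => ε / (1 - 4 * ε)) 0 :=
        ContinuousAt.div (by fun_prop) (by fun_prop) (by simp)
      simpa using this.tendsto.mono_left nhdsWithin_le_nhds
    · filter_upwards [Ioo_mem_nhdsGT (show (0 : ℝ) < 1 / 4 by norm_num)] with ε hε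
      exact div_pos hε.1 (by linarith [hε.2])
  have h3 : Tendsto (fun ε : ℝ => (1 - 4 * ε : ℂ) ^ (-(n : ℂ) / 2)) (𝓝[>] 0) (𝓝 1) := by
    have : ContinuousAt (fun ε : ℝ => (1 - 4 * ε : ℂ) ^ (-(n : ℂ) / 2)) 0 := by
      refine ContinuousAt.comp (x := (0 : ℝ)) (f := fun ε : ℝ => (1 - 4 * ε : ℂ))
        (continuousAt_cpow_const ?_) (by fun_prop)
      simp
    simpa using this.tendsto.mono_left nhdsWithin_le_nhds
  have h4 := h3.mul (h1.comp h2)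
  rw [one_mul] at h4
  change Tendsto _ _ (𝓝 (f b)) at h4
  rw [hfb] at h4
  refine h4.congr' ?_
  filter_upwards [Ioo_mem_nhdsGT (show (0 : ℝ) < 1 / 4 by norm_num)] with ε hε
  simp only [Function.comp_apply]
  rw [← integral_const_mul]
  refine integral_congr_ae (Eventually.of_forall fun x => ?_)
  simp only
  rw [heatKernel_eq_mul_exp hε.1 (by linarith [hε.2]) (x - b), hf]
  ring

/-! ### Uniqueness of square integrable solutions of the free Schrödinger equation -/

lemma enorm_add_sq_le (a b : ℂ) : ‖a + b‖ₑ ^ 2 ≤ 3 * (‖a‖ₑ ^ 2 + ‖b‖ₑ ^ 2) := by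
  simpa using enorm_add_add_sq_le a b 0

lemma lintegral_enorm_mul_le {w v : EuclideanSpace ℝ (Fin n) → ℂ} (hw : Continuous w)
    (hv : Continuous v) :
    ∫⁻ x, ‖w x * v x‖ₑ ≤
      (∫⁻ x, ‖w x‖ₑ ^ 2) ^ (1 / 2 : ℝ) * (∫⁻ x, ‖v x‖ₑ ^ 2) ^ (1 / 2 : ℝ) := by
  have h := ENNReal.lintegral_mul_le_Lp_mul_Lq volume Real.HolderConjugate.two_two
    hw.measurable.enorm.aemeasurable hv.measurable.enorm.aemeasurable
  simpa only [enorm_mul, ENNReal.rpow_two, Pi.mul_apply] using h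

section Uniqueness

variable {t₀ t₁ : ℝ} {w v G : ℝ → EuclideanSpace ℝ (Fin n) → ℂ} {k : Set (EuclideanSpace ℝ (Fin n))}

/-- Pairings with square integrable functions converge at the initial time. -/
lemma tendsto_integral_mul_initial (ht : t₀ < t₁) (hw : ∀ t ∈ Ioo t₀ t₁, Continuous (w t))
    (hG : ContinuousOn (fun q : ℝ × EuclideanSpace ℝ (Fin n) => G q.1 q.2) (Icc t₀ t₁ ×ˢ univ))
    (hk : IsCompact k) (hGk : ∀ t x, x ∉ k → G t x = 0)
    (hinit : Tendsto (fun t => ∫⁻ x, ‖w t x - G t x‖ₑ ^ 2) (𝓝[>] t₀) (𝓝 0))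
    (hv : Continuous fun q : ℝ × EuclideanSpace ℝ (Fin n) => v q.1 q.2)
    {h : EuclideanSpace ℝ (Fin n) → ℝ} (hh : Integrable fun x => h x ^ 2)
    (hvh : ∀ t ∈ Icc t₀ t₁, ∀ x, ‖v t x‖ ≤ h x) :
    Tendsto (fun t => ∫ x, w t x * v t x) (𝓝[>] t₀) (𝓝 (∫ x, G t₀ x * v t₀ x)) ∧
    ∀ᶠ t in 𝓝[>] t₀, ∫⁻ x, ‖w t x‖ₑ ^ 2 < ⊤ := by
  have hGc : ∀ t ∈ Icc t₀ t₁, Continuous (G t) := fun t ht =>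
    hG.comp_continuous (f := fun x => (t, x)) (by fun_prop) fun x => ⟨ht, trivial⟩
  have hvc : ∀ t, Continuous (v t) := fun t => hv.comp (by fun_prop : Continuous fun x => (t, x))
  have hGs : ∀ t, HasCompactSupport (G t) := fun t => HasCompactSupport.intro hk (hGk t)
  have hG2 : ∀ t ∈ Icc t₀ t₁, ∫⁻ x, ‖G t x‖ₑ ^ 2 < ⊤ := fun t ht => by
    have h1 : Integrable fun x => ‖G t x‖ ^ 2 := by
      have h2 : Continuous fun x => ‖G t x‖ ^ 2 := (hGc t ht).norm.pow 2
      exact h2.integrable_of_hasCompactSupport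
        (HasCompactSupport.intro hk fun x hx => by simp [hGk t x hx])
    refine lt_of_eq_of_lt (lintegral_congr fun x => ?_) h1.lintegral_lt_top
    rw [ENNReal.ofReal_pow (norm_nonneg _), ofReal_norm]
  set H := ∫⁻ x, ENNReal.ofReal (h x ^ 2)
  have hH : H < ⊤ := hh.lintegral_lt_top
  have hvH : ∀ t ∈ Icc t₀ t₁, ∫⁻ x, ‖v t x‖ₑ ^ 2 ≤ H := fun t ht => by
    refine lintegral_mono fun x => ?_
    rw [← ofReal_norm, ← ENNReal.ofReal_pow (norm_nonneg _)]
    exact ENNReal.ofReal_le_ofReal (pow_le_pow_left₀ (norm_nonneg _) (hvh t ht x) 2)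
  have hfin : ∀ᶠ t in 𝓝[>] t₀, t ∈ Ioo t₀ t₁ ∧ ∫⁻ x, ‖w t x - G t x‖ₑ ^ 2 < ⊤ := by
    filter_upwards [Ioo_mem_nhdsGT ht, hinit.eventually_lt_const ENNReal.zero_lt_top] with t h1 h2
    exact ⟨h1, h2⟩
  constructor
  -- Split ∫wv = ∫(w-G)v + ∫Gv. The first part vanishes by Cauchy–Schwarz and `hinit`; the second is
  -- continuous up to t₀ because G(t) is supported in the fixed compact set k.
  · have h1 : ContinuousOn (fun t => ∫ x, G t x * v t x) (Icc t₀ t₁) := by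
      refine continuousOn_integral_of_compact_support hk (hG.mul hv.continuousOn) ?_
      intro t x _ hx
      rw [hGk t x hx, zero_mul]
    have h3 : 𝓝[>] t₀ ≤ 𝓝[Icc t₀ t₁] t₀ := by
      rw [← nhdsWithin_Ioo_eq_nhdsGT ht]
      exact nhdsWithin_mono _ Ioo_subset_Icc_self
    have h2 := (h1 t₀ ⟨le_rfl, ht.le⟩).tendsto.mono_left h3
    have h4 : Tendsto (fun t => ∫ x, (w t x - G t x) * v t x) (𝓝[>] t₀) (𝓝 0) := by
      rw [tendsto_zero_iff_enorm_tendsto_zero]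
      have h5 : Tendsto (fun t => (∫⁻ x, ‖w t x - G t x‖ₑ ^ 2) ^ (1 / 2 : ℝ) * H ^ (1 / 2 : ℝ))
          (𝓝[>] t₀) (𝓝 0) := by
        have h6 := (ENNReal.continuous_rpow_const (y := 1 / 2)).tendsto 0 |>.comp hinit
        rw [ENNReal.zero_rpow_of_pos (by norm_num)] at h6
        have h7 := ENNReal.Tendsto.mul_const (b := H ^ (1 / 2 : ℝ)) h6
          (Or.inr (ENNReal.rpow_lt_top_of_nonneg (by norm_num) hH.ne).ne)
        simpa using h7
      refine tendsto_of_tendsto_of_tendsto_of_le_of_le' tendsto_const_nhds h5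
        (Eventually.of_forall fun t => bot_le) ?_
      filter_upwards [Ioo_mem_nhdsGT ht] with t ht'
      have ht'' := Ioo_subset_Icc_self ht'
      refine (enorm_integral_le_lintegral_enorm _).trans
        ((lintegral_enorm_mul_le (w := fun x => w t x - G t x) ((hw t ht').sub (hGc t ht'')) (hvc t)).trans ?_)
      gcongr
      exact hvH t ht''
    have h5 := h4.add h2
    rw [zero_add] at h5
    refine h5.congr' ?_
    filter_upwards [hfin] with t ⟨ht', hlt⟩
    have ht'' := Ioo_subset_Icc_self ht'
    rw [← integral_add]
    · refine integral_congr_ae (Eventually.of_forall fun x => ?_)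
      simp only
      ring
    · exact integrable_mul_of_lintegral_sq ((hw t ht').sub (hGc t ht'')) (hvc t) hh (hvh t ht'') hlt
    · exact ((hGc t ht'').mul (hvc t)).integrable_of_hasCompactSupport (hGs t).mul_right
  · filter_upwards [hfin] with t ⟨ht', hlt⟩
    have ht'' := Ioo_subset_Icc_self ht'
    have hm : Measurable fun x => ‖w t x - G t x‖ₑ ^ 2 :=
      ((hw t ht').sub (hGc t ht'')).measurable.enorm.pow_const 2
    calc ∫⁻ x, ‖w t x‖ₑ ^ 2 ≤ ∫⁻ x, 3 * (‖w t x - G t x‖ₑ ^ 2 + ‖G t x‖ₑ ^ 2) :=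
          lintegral_mono fun x => by simpa using enorm_add_sq_le (w t x - G t x) (G t x)
      _ = 3 * ((∫⁻ x, ‖w t x - G t x‖ₑ ^ 2) + ∫⁻ x, ‖G t x‖ₑ ^ 2) := by
          rw [lintegral_const_mul' _ _ (by norm_num), lintegral_add_left hm]
      _ < ⊤ := ENNReal.mul_lt_top (by norm_num) (ENNReal.add_lt_top.2 ⟨hlt, hG2 t ht''⟩)

/-- A square integrable solution of the free Schrödinger equation is the free flow of its initial
datum. -/
lemma eq_heatFlow_of_square_integrable {κ : ℝ} (hκ : 0 < κ) (ht : t₀ < t₁) (hw : IsC21On t₀ t₁ w)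
    (hweq : ∀ t ∈ Ioo t₀ t₁, ∀ x, deriv (fun s => w s x) t =
      Complex.I * κ * Laplacian.laplacian (w t) x)
    (hw2 : ∫⁻ t in Ioo t₀ t₁, ∫⁻ x, ‖w t x‖ₑ ^ 2 < ⊤)
    (hG : ContinuousOn (fun q : ℝ × EuclideanSpace ℝ (Fin n) => G q.1 q.2) (Icc t₀ t₁ ×ˢ univ))
    (hk : IsCompact k) (hGk : ∀ t x, x ∉ k → G t x = 0)
    (hinit : Tendsto (fun t => ∫⁻ x, ‖w t x - G t x‖ₑ ^ 2) (𝓝[>] t₀) (𝓝 0))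
    {t : ℝ} (htt : t ∈ Ioo t₀ t₁) (b : EuclideanSpace ℝ (Fin n)) :
    w t b = heatFlow (G t₀) (Complex.I * (κ * (t - t₀) : ℝ)) b := by
  have hg : Continuous (G t₀) :=
    hG.comp_continuous (f := fun x => (t₀, x)) (by fun_prop) fun x => ⟨⟨le_rfl, ht.le⟩, trivial⟩
  have hgc : HasCompactSupport (G t₀) := HasCompactSupport.intro hk (hGk t₀)
  have hwc : ∀ t ∈ Ioo t₀ t₁, Continuous (w t) := fun t ht => (hw.contDiff_space t ht).continuous
  -- Conservation of the pairing can be used only when the slice at the final time is square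
  -- integrable.
  have key : ∀ t ∈ Ioo t₀ t₁, ∫⁻ x, ‖w t x‖ₑ ^ 2 < ⊤ →
      w t b = heatFlow (G t₀) (Complex.I * (κ * (t - t₀) : ℝ)) b := by
    intro s hs hsw
    have hpair : ∀ ε : ℝ, 0 < ε → ∫ x, w s x * heatKernel (ε : ℂ) (x - b) =
        heatFlow (G t₀) (ε + Complex.I * (κ * (s - t₀) : ℝ)) b := by
      intro ε hε
      -- With this α the test function at time r is the kernel at complex time ε + iκ(s-r). Its real
      -- part is always ε; at r = s it is the approximate identity, and at r = t₀ it is the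
      -- regularised Schrödinger kernel.
      set α : ℂ := ε + Complex.I * κ * s with hα
      have hre : ∀ r : ℝ, (α + -(Complex.I * κ) * r).re = ε := fun r => by simp [hα]
      have hz : ∀ r ∈ Ioo t₀ t₁, α + -(Complex.I * κ) * (r : ℝ) ∈ Complex.slitPlane :=
        fun r _ => mem_slitPlane_of_re_pos ((hre r).symm ▸ hε)
      obtain ⟨B, c, hc, hB⟩ := exists_heatKernel_gaussian_bound n hε
        (Z := ε + κ * (t₁ - t₀)) (by
          have := sub_pos.2 ht
          positivity)
      have hnorm : ∀ r ∈ Icc t₀ t₁, ‖α + -(Complex.I * κ) * (r : ℝ)‖ ≤ ε + κ * (t₁ - t₀) := by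
        intro r hr
        have e : α + -(Complex.I * κ) * (r : ℝ) = ε + Complex.I * ((κ * (s - r) : ℝ) : ℂ) := by
          rw [hα]
          push_cast
          ring
        rw [e]
        refine (norm_add_le _ _).trans ?_
        rw [norm_mul, Complex.norm_I, one_mul, Complex.norm_real, Complex.norm_real,
          Real.norm_of_nonneg hε.le, Real.norm_eq_abs, abs_mul, abs_of_pos hκ]
        gcongr
        exact abs_le.2 ⟨by linarith [hs.1, hr.2], by linarith [hs.2, hr.1]⟩
      set v : ℝ → EuclideanSpace ℝ (Fin n) → ℂ :=
        fun r x => heatKernel (α + -(Complex.I * κ) * r) (x - b) with hv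
      set h : EuclideanSpace ℝ (Fin n) → ℝ := fun x => B * Real.exp (-c * ‖x - b‖ ^ 2) with hh
      have hhi : Integrable fun x => h x ^ 2 := by
        refine ((integrable_exp_neg_mul_sq_norm (c := 2 * c) (by positivity) b).const_mul
          (B ^ 2)).congr (Eventually.of_forall fun x => ?_)
        simp only [hh, mul_pow, ← Real.exp_nat_mul]
        congr 2
        push_cast
        ring
      have hvh : ∀ r ∈ Icc t₀ t₁, ∀ x, ‖v r x‖ ≤ h x := fun r hr x =>
        (hB _ (hre r) (hnorm r hr) (x - b)).1
      have hvh' : ∀ r ∈ Ioo t₀ t₁, ∀ j x, ‖spaceDeriv (v r) j x‖ ≤ h x := by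
        intro r hr j x
        have e : spaceDeriv (v r) j x =
            spaceDeriv (heatKernel (α + -(Complex.I * κ) * r)) j (x - b) := by
          rw [spaceDeriv, spaceDeriv, hv, fderiv_comp_sub]
        rw [e]
        exact (hB _ (hre r) (hnorm r (Ioo_subset_Icc_self hr)) (x - b)).2 j
      have hvc : Continuous fun q : ℝ × EuclideanSpace ℝ (Fin n) => v q.1 q.2 :=
        continuousOn_heatKernel.comp_continuous (f := fun q : ℝ × EuclideanSpace ℝ (Fin n) =>
          (α + -(Complex.I * κ) * (q.1 : ℂ), q.2 - b)) (by fun_prop)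
          fun q => ⟨mem_slitPlane_of_re_pos ((hre q.1).symm ▸ hε), trivial⟩
      obtain ⟨hlim, hfin⟩ := tendsto_integral_mul_initial ht hwc hG hk hGk hinit hvc hhi hvh
      have hconst : ∀ᶠ r in 𝓝[>] t₀, ∫ x, w r x * v r x = ∫ x, w s x * v s x := by
        filter_upwards [hfin, Ioo_mem_nhdsGT hs.1] with r hr hrs
        exact (integral_mul_eq_of_square_integrable hw (isC21On_heatKernel hz b) hweq
          (fun r hr x => deriv_heatKernel_eq hz b x hr)
          (fun r hr => hvh r (Ioo_subset_Icc_self hr)) hvh' hhi hw2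
          ⟨hrs.1, hrs.2.trans hs.2⟩ hs hrs.2.le hr hsw).symm
      have h1 := tendsto_nhds_unique (hlim.congr' hconst) tendsto_const_nhds
      have e1 : α + -(Complex.I * κ) * s = ε := by rw [hα]; ring
      have e2 : α + -(Complex.I * κ) * t₀ = ε + Complex.I * (κ * (s - t₀) : ℝ) := by
        rw [hα]
        push_cast
        ring
      simp only [hv, e1, e2] at h1
      rw [← h1, heatFlow]
      refine integral_congr_ae (Eventually.of_forall fun x => ?_)
      simp only
      rw [heatKernel_sub_comm, mul_comm]
    have h1 := tendsto_integral_heatKernel_mul_of_sq (hwc s hs) hsw b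
    have h2 := tendsto_heatFlow_add_I hg hgc (τ := κ * (s - t₀))
      (mul_pos hκ (sub_pos.2 hs.1)).ne' 0 b
    simp only [Complex.ofReal_zero, add_zero, zero_add] at h2
    refine tendsto_nhds_unique h1 (h2.congr' ?_)
    filter_upwards [self_mem_nhdsWithin] with ε hε using (hpair ε hε).symm
  have hmeas : AEMeasurable (fun t => ∫⁻ x, ‖w t x‖ₑ ^ 2) (volume.restrict (Ioo t₀ t₁)) := by
    have h1 : AEMeasurable (fun q : ℝ × EuclideanSpace ℝ (Fin n) => ‖w q.1 q.2‖ₑ ^ 2)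
        ((volume.restrict (Ioo t₀ t₁)).prod volume) := by
      have h2 : AEMeasurable (fun q : ℝ × EuclideanSpace ℝ (Fin n) => w q.1 q.2)
          ((volume.prod volume).restrict (Ioo t₀ t₁ ×ˢ univ)) :=
        hw.continuousOn.aemeasurable (measurableSet_Ioo.prod MeasurableSet.univ)
      rw [← Measure.prod_restrict, Measure.restrict_univ] at h2
      exact h2.enorm.pow_const 2
    exact h1.lintegral_prod_right'
  -- By Tonelli almost every slice is square integrable. Both sides are continuous in t, so almost
  -- everywhere becomes everywhere.
  have hae : ∀ᵐ t ∂volume.restrict (Ioo t₀ t₁), w t b =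
      heatFlow (G t₀) (Complex.I * (κ * (t - t₀) : ℝ)) b := by
    filter_upwards [ae_lt_top' hmeas hw2.ne, ae_restrict_mem measurableSet_Ioo] with t h1 h2
      using key t h2 h1
  refine Measure.eqOn_open_of_ae_eq hae isOpen_Ioo ?_ ?_ htt
  · exact hw.continuousOn.comp (f := fun t => (t, b)) (by fun_prop) fun t ht => ⟨ht, trivial⟩
  · refine (continuousOn_heatFlow hg hgc).comp
      (f := fun t : ℝ => (Complex.I * ((κ * (t - t₀) : ℝ) : ℂ), b)) (by fun_prop) fun t ht =>
      ⟨Complex.mem_slitPlane_iff.2 (Or.inr ?_), trivial⟩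
    have : 0 < κ * (t - t₀) := mul_pos hκ (sub_pos.2 ht.1)
    rw [Complex.mul_im, Complex.ofReal_re, Complex.ofReal_im]
    simpa only [Complex.I_re, Complex.I_im, zero_mul, zero_add, one_mul] using this.ne'

end Uniqueness

/-! ### Uniqueness of the fundamental solution -/

/-- The uniqueness result is applied to w = ψu with κ = ħ/2m and the moving datum G = ψf, since
|u-f|²|ψ|² = |w-G|². -/
lemma IsCauchySolution.mul_eq_heatFlow {hbar m t₀ t₁ : ℝ} (hbar_pos : 0 < hbar) (hm : 0 < m)
    (ht : t₀ < t₁) {ψ u : ℝ → EuclideanSpace ℝ (Fin n) → ℂ}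
    {ψ₀ f : EuclideanSpace ℝ (Fin n) → ℂ} (hψ : IsNonvanishingFreeWave hbar m t₀ t₁ ψ ψ₀)
    (hu : IsCauchySolution hbar m t₀ t₁ ψ u f) (hf : Continuous f) (hc : HasCompactSupport f)
    {t : ℝ} (htt : t ∈ Ioo t₀ t₁) (x : EuclideanSpace ℝ (Fin n)) :
    ψ t x * u t x =
      heatFlow (fun y => ψ₀ y * f y) (Complex.I * hbar / (2 * m) * (t - t₀)) x := by
  have hu21 := hu.isDriftSolution.isC21On
  have hκ : (Complex.I * ((hbar / (2 * m) : ℝ) : ℂ)) = Complex.I * hbar / (2 * m) := by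
    push_cast
    ring
  have h := eq_heatFlow_of_square_integrable (κ := hbar / (2 * m)) (w := fun t x => ψ t x * u t x)
    (G := fun t x => ψ t x * f x) (k := tsupport f) (by positivity) ht (hψ.isC21On.mul hu21)
    (fun t ht x => by
      rw [hκ]
      exact (schrodinger_iff_drift hm hψ hu21 ht x).2 (hu.isDriftSolution.equation t ht x))
    hu.weighted_sq_integrable (hψ.continuousOn.mul (hf.comp continuous_snd).continuousOn) hc
    (fun t x hx => by simp [image_eq_zero_of_notMem_tsupport hx]) ?_ htt x
  · rw [I_mul_hbar_div_mul_eq]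
    simpa only [hψ.initial] using h
  · refine hu.initial.congr fun t => lintegral_congr fun x => ?_
    rw [← mul_sub, enorm_mul, mul_pow, mul_comm]

/-- For fixed (t,x) both kernels integrate every test function in y to the same value, so they agree
almost everywhere in y, and everywhere by continuity in y. -/
lemma IsFundamentalSolution.mul_eq {hbar m t₀ t₁ : ℝ} (hbar_pos : 0 < hbar) (hm : 0 < m)
    (ht : t₀ < t₁) {ψ : ℝ → EuclideanSpace ℝ (Fin n) → ℂ} {ψ₀ : EuclideanSpace ℝ (Fin n) → ℂ}
    (hψ : IsNonvanishingFreeWave hbar m t₀ t₁ ψ ψ₀)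
    {p : EuclideanSpace ℝ (Fin n) → ℝ → EuclideanSpace ℝ (Fin n) → ℂ}
    (hp : IsFundamentalSolution hbar m t₀ t₁ ψ p) (y : EuclideanSpace ℝ (Fin n)) {t : ℝ}
    (htt : t ∈ Ioo t₀ t₁) (x : EuclideanSpace ℝ (Fin n)) :
    ψ t x * p y t x = ψ₀ y * heatKernel (Complex.I * hbar / (2 * m) * (t - t₀)) (x - y) := by
  set z : ℂ := Complex.I * hbar / (2 * m) * (t - t₀)
  have hp_cont : Continuous fun y => p y t x :=
    hp.continuousOn.comp_continuous (f := fun y => (y, t, x)) (by fun_prop)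
      fun y => ⟨trivial, Ioo_subset_Ioc_self htt, trivial⟩
  have hK_cont : Continuous fun y => ψ₀ y * heatKernel z (x - y) :=
    (hψ.continuous_initial ht).mul ((continuous_heatKernel z).comp (by fun_prop))
  set d := fun y => ψ t x * p y t x - ψ₀ y * heatKernel z (x - y) with hd
  have hd_cont : Continuous d := (continuous_const.mul hp_cont).sub hK_cont
  have hae : ∀ᵐ y, d y = 0 := by
    refine ae_eq_zero_of_integral_contDiff_smul_eq_zero hd_cont.locallyIntegrable
      fun g hg hgc => ?_
    set f : EuclideanSpace ℝ (Fin n) → ℂ := fun y => (g y : ℂ)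
    have hf : Continuous f := Complex.continuous_ofReal.comp hg.continuous
    have hfc : HasCompactSupport f := hgc.comp_left Complex.ofReal_zero
    have h := (hp.cauchy f hf hfc).mul_eq_heatFlow hbar_pos hm ht hψ hf hfc htt x
    rw [heatFlow, ← integral_const_mul] at h
    have i1 : Integrable fun y => ψ t x * (p y t x * f y) :=
      (continuous_const.mul (hp_cont.mul hf)).integrable_of_hasCompactSupport
        hfc.mul_left.mul_left
    have i2 : Integrable fun y => heatKernel z (x - y) * (ψ₀ y * f y) :=
      (((continuous_heatKernel z).comp (by fun_prop)).mul
        ((hψ.continuous_initial ht).mul hf)).integrable_of_hasCompactSupport hfc.mul_left.mul_left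
    rw [← sub_eq_zero, ← integral_sub i1 i2] at h
    rw [← h]
    refine integral_congr_ae (Eventually.of_forall fun y => ?_)
    simp only [hd, Complex.real_smul, f]
    ring
  have h0 : d = fun _ => 0 := (hd_cont.ae_eq_iff_eq volume continuous_const).1 hae
  exact sub_eq_zero.1 (congrFun h0 y)

end FreeSchrodinger

theorem mainTheorem2 (n : ℕ) (hbar m t₀ t₁ : ℝ) (hbar_pos : 0 < hbar) (hm : 0 < m) (ht : t₀ < t₁)
    (ψ : ℝ → EuclideanSpace ℝ (Fin n) → ℂ) (ψ₀ : EuclideanSpace ℝ (Fin n) → ℂ)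
    (hψ : IsNonvanishingFreeWave hbar m t₀ t₁ ψ ψ₀) :
    (∃ p, IsFundamentalSolution hbar m t₀ t₁ ψ p) ∧
    ∀ p, IsFundamentalSolution hbar m t₀ t₁ ψ p →
      ∀ y, ∀ t ∈ Set.Ioc t₀ t₁, ∀ x,
        ψ t x / ψ₀ y * p y t x = freeSchrodingerKernel hbar m t₀ y t x := by
  refine ⟨exists_isFundamentalSolution hbar_pos hm hψ ht, fun p hp y t htt x => ?_⟩
  have hψ₀ : ψ₀ y ≠ 0 := by
    rw [← hψ.initial y]
    exact hψ.ne_zero t₀ ⟨le_rfl, ht.le⟩ y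
  -- The equation says nothing at t₁; the identity reaches that time by continuity of both sides on
  -- (t₀, t₁].
  have heq : Set.EqOn (fun t => ψ t x * p y t x)
      (fun t => ψ₀ y * heatKernel (Complex.I * hbar / (2 * m) * (t - t₀)) (x - y))
      (Set.Ioc t₀ t₁) := by
    refine Set.EqOn.of_subset_closure (s := Set.Ioo t₀ t₁)
      (fun t htt => hp.mul_eq hbar_pos hm ht hψ y htt x) ?_ ?_ Set.Ioo_subset_Ioc_self ?_
    · refine ContinuousOn.mul ?_ ?_
      · exact hψ.continuousOn.comp (f := fun t => (t, x)) (by fun_prop)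
          fun t ht => ⟨Set.Ioc_subset_Icc_self ht, trivial⟩
      · exact hp.continuousOn.comp (f := fun t => (y, t, x)) (by fun_prop)
          fun t ht => ⟨trivial, ht, trivial⟩
    · refine continuousOn_const.mul (continuousOn_heatKernel.comp (f := fun t : ℝ =>
        ((Complex.I * hbar / (2 * m) * (t - t₀) : ℂ), x - y)) ?_ ?_)
      · exact Continuous.continuousOn (by fun_prop)
      · exact fun t ht => ⟨I_mul_hbar_div_mul_mem_slitPlane hbar_pos hm ht.1, trivial⟩
    · rw [closure_Ioo ht.ne]
      exact Set.Ioc_subset_Icc_self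
  rw [freeSchrodingerKernel_eq_heatKernel hbar_pos hm htt.1, div_mul_eq_mul_div,
    div_eq_iff hψ₀, mul_comm _ (ψ₀ y)]
  exact heq htt
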